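/- Let $K$ be a local field, i.e. a complete discretely valued field with perfect residue field $\kappa$ (of any characteristic), let $K^{\mathrm{alg}}$ be an algebraic closure of $K$, and let $G_K=\mathrm{Aut}(K^{\mathrm{alg}}/K)$. All algebraic extensions of $K$ are taken inside $K^{\mathrm{alg}}$; let $\bar\kappa$ be the residue field of $K^{\mathrm{alg}}$. Let $\mathbb{Q}^{\mathrm{alg}}$ be an algebraic closure of $\mathbb{Q}$ and $\mu_n=\mu_n(\mathbb{Q}^{\mathrm{alg}})$. Fix an embedding of $\mathbb{Q}^{\mathrm{alg}}$ into $K^{\mathrm{alg}}$ if $\operatorname{char}K=0$, and into an algebraic closure of $\operatorname{Frac}W(\bar\kappa)$ if $\operatorname{char}K=p>0$. For $n$ prime to $\operatorname{char}\kappa$, Teichmüller lifting then identifies $\mu_n(\bar\kappa)$ with $\mu_n$. **Notation.** For functions $\chi_1,\chi_2$ on a finite group $G$ with values in a field of characteristic zero, put $\overline{\chi_2}(g)=\chi_2(g^{-1})$ and $(\chi_1|\chi_2)_G=\frac1{|G|}\sum_{g\in G}\chi_1(g)\overline{\chi_2}(g)$. For a homomorphism $\alpha:G\to G'$ of finite groups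 and a central function $\chi$ on $G$, let $\alpha_*\chi$ be the unique central function on $G'$ with $(\chi'|\alpha_*\chi)_{G'}=(\chi'\circ\alpha|\chi)_G$ for all central functions $\chi'$ on $G'$; for an inclusion $H\subseteq G$ write $\mathrm{Ind}_H^G$ for the pushforward. Let $\mathbf u_G=\mathbf r_G-\mathbf 1_G$ be the regular minus the trivial character. For $n\ge 1$ let $\mathrm{bAr}_n:\mu_n\to\mathbb{Q}^{\mathrm{alg}}$, $\mathrm{bAr}_n(\zeta)=\frac1n\sum_{r=0}^{n-1}r\,\zeta^r$. Let $L/K$ be a finite Galois extension with group $\Gamma$ and lower numbering ramification groups $\Gamma_i$, let $n=|\Gamma_0/\Gamma_1|$, and let $\psi_{L/K}:\Gamma_0\to\Gamma_0/\Gamma_1\cong\mu_n$ be the homomorphism that sends $\sigma$ to the $n$-th root of unity corresponding to the residue class of $\sigma(\pi)/\pi$, for any uniformizer $\pi$ of the maximal tamely ramified subextension $L^{\Gamma_1}$. Define $$\mathrm{Ar}_{L/K}=\sum_{i\ge0}\frac1{[\Gamma_0:\Gamma_i]}\mathrm{Ind}_{\Gamma_i}^{\Gamma}\mathbf u_{\Gamma_i},$$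 $$\mathrm{bAr}_{L/K}=\mathrm{Ind}_{\Gamma_0}^{\Gamma}\Bigl(\mathrm{bAr}_n\circ\psi_{L/K}+\tfrac12\mathrm{Ind}_{\Gamma_1}^{\Gamma_0}\mathbf u_{\Gamma_1}+\tfrac12\sum_{i\ge1}\frac1{[\Gamma_0:\Gamma_i]}\mathrm{Ind}_{\Gamma_i}^{\Gamma_0}\mathbf u_{\Gamma_i}\Bigr).$$ **Statement.** 1. If $M/K$ is a Galois subextension of a finite Galois extension $L/K$ and $\alpha:\mathrm{Gal}(L/K)\to\mathrm{Gal}(M/K)$ is the projection, then $\alpha_*\mathrm{bAr}_{L/K}=\mathrm{bAr}_{M/K}$. 2. Let $F$ be a field containing $\mathbb{Q}^{\mathrm{alg}}$. There is exactly one distribution $\mathrm{bAr}_K$ (an $F$-linear form on the space of locally constant central functions $G_K\to F$) such that $\mathrm{bAr}_K(f)=(\mathrm{bAr}_{L/K}|\varphi)_{\mathrm{Gal}(L/K)}$ whenever $L/K$ is finite Galois and $f$ is the inflation of a function $\varphi:\mathrm{Gal}(L/K)\to F$. In the same way the characters $\mathrm{Ar}_{L/K}$ define exactly one distribution $\mathrm{Ar}_K$.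 3. $\mathrm{bAr}_K$ is a bisection of $\mathrm{Ar}_K$: one has $\mathrm{Ar}_K=\mathrm{bAr}_K+\overline{\mathrm{bAr}_K}$, where $\overline{\mathrm{bAr}_K}(f)=\mathrm{bAr}_K(\overline f)$ and $\overline f(g)=f(g^{-1})$. -/

import Mathlib

open scoped NormedField Valued

noncomputable section

namespace RefinedArtin

/-! ### Central functions on (finite) groups -/

section CentralFunctions

variable {G G' F : Type*} [Group G] [Group G'] [Field F]

/-- A function on a group is central if it is constant on conjugacy classes. -/
def IsCentral {X : Type*} (f : G → X) : Prop :=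
  ∀ g h : G, f (h * g * h⁻¹) = f g

/-- The conjugate `g ↦ χ(g⁻¹)` of a function on a group. -/
def conj {X : Type*} (χ : G → X) : G → X := fun g => χ g⁻¹

/-- The pairing `(χ₁ | χ₂)_G = |G|⁻¹ ∑_g χ₁(g) χ₂(g⁻¹)` of functions on a finite group. -/
def pairing (χ₁ χ₂ : G → F) : F :=
  (Nat.card G : F)⁻¹ * ∑ᶠ g : G, χ₁ g * conj χ₂ g

/-- The pushforward `α_* χ` of a function `χ` along a homomorphism `α : G → G'` of finite groups:
`(α_* χ)(g') = |G|⁻¹ ∑_{x ∈ G'} ∑_{g ∈ G, α(g) = x g' x⁻¹} χ(g)`.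
For injective `α` this is induction. It is the unique central function on `G'` that is adjoint
to `χ' ↦ χ' ∘ α` for `pairing`; see `isCentral_pushforward`, `pairing_pushforward` and
`eq_pushforward` below. -/
def pushforward (α : G →* G') (χ : G → F) : G' → F := fun g' =>
  (Nat.card G : F)⁻¹ * ∑ᶠ x : G', ∑ᶠ (g : G) (_ : α g = x * g' * x⁻¹), χ g

/-- The regular character of a finite group. -/
def regularChar (G F : Type*) [Group G] [Field F] : G → F :=
  open Classical in fun g => if g = 1 then (Nat.card G : F) else 0

/-- The augmentation character `u_G = r_G - 1_G` of a finite group. -/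
def augChar (G F : Type*) [Group G] [Field F] : G → F := regularChar G F - 1

theorem isCentral_pushforward [Finite G] [Finite G'] (α : G →* G') (χ : G → F) :
    IsCentral (pushforward α χ) := by
  intro g' h
  unfold pushforward
  congr 1
  refine finsum_eq_of_bijective (fun x => x * h) (Group.mulRight_bijective h) fun x => ?_
  have : x * (h * g' * h⁻¹) * x⁻¹ = x * h * g' * (x * h)⁻¹ := by group
  rw [this]

/-- The defining property `(χ' | α_* χ)_{G'} = (α^* χ' | χ)_G` of the pushforward. -/
theorem pairing_pushforward [Finite G] [Finite G'] [CharZero F] (α : G →* G') (χ : G → F)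
    (χ' : G' → F) (hχ' : IsCentral χ') :
    pairing χ' (pushforward α χ) = pairing (χ' ∘ α) χ := by
  classical
  have := Fintype.ofFinite G
  have := Fintype.ofFinite G'
  have hG' : (Nat.card G' : F) ≠ 0 := by exact_mod_cast Nat.card_pos.ne'
  have key : ∀ x : G', ∑ g' : G', χ' g' * ∑ g : G, (if α g = x * g'⁻¹ * x⁻¹ then χ g else 0)
      = ∑ g : G, χ' (α g) * χ g⁻¹ := by
    intro x
    simp_rw [Finset.mul_sum]
    rw [Finset.sum_comm, ← Equiv.sum_comp (Equiv.inv G) (fun g => χ' (α g) * χ g⁻¹)]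
    refine Finset.sum_congr rfl fun g _ => ?_
    rw [Finset.sum_eq_single (x⁻¹ * (α g)⁻¹ * x)]
    · have h1 : α g = x * (x⁻¹ * (α g)⁻¹ * x)⁻¹ * x⁻¹ := by group
      rw [if_pos h1]
      have h2 := hχ' (α g)⁻¹ x⁻¹
      rw [inv_inv] at h2
      simp [h2]
    · intro b _ hb
      rw [if_neg, mul_zero]
      intro h
      apply hb
      rw [h]
      group
    · intro h
      exact absurd (Finset.mem_univ _) h
  unfold pairing pushforward conj
  simp only [finsum_eq_sum_of_fintype, finsum_eq_if, Function.comp]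
  have : ∀ g' : G', χ' g' * ((Nat.card G : F)⁻¹ * ∑ x : G', ∑ g : G,
      (if α g = x * g'⁻¹ * x⁻¹ then χ g else 0)) = (Nat.card G : F)⁻¹ * ∑ x : G',
      χ' g' * ∑ g : G, (if α g = x * g'⁻¹ * x⁻¹ then χ g else 0) := by
    intro g'
    rw [Finset.mul_sum, Finset.mul_sum, Finset.mul_sum]
    exact Finset.sum_congr rfl fun x _ => by ring
  simp_rw [this]
  rw [← Finset.mul_sum, Finset.sum_comm]
  simp_rw [key]
  rw [Finset.sum_const, Finset.card_univ, ← Nat.card_eq_fintype_card (α := G'), nsmul_eq_mul]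
  field_simp

/-- The pushforward is the only central function with its defining property. -/
theorem eq_pushforward [Finite G] [Finite G'] [CharZero F] (α : G →* G') (χ : G → F)
    (ψ : G' → F) (hψ : IsCentral ψ)
    (h : ∀ χ' : G' → F, IsCentral χ' → pairing χ' ψ = pairing (χ' ∘ α) χ) :
    ψ = pushforward α χ := by
  classical
  have := Fintype.ofFinite G'
  have hG' : (Nat.card G' : F) ≠ 0 := by exact_mod_cast Nat.card_pos.ne'
  have hp := isCentral_pushforward α χ
  ext a
  set χ' : G' → F := fun g => if IsConj a⁻¹ g then 1 else 0 with hχ'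
  have hc : IsCentral χ' := by
    intro g k
    have : IsConj a⁻¹ (k * g * k⁻¹) ↔ IsConj a⁻¹ g :=
      ⟨fun q => q.trans (isConj_iff.2 ⟨k⁻¹, by group⟩), fun q => q.trans (isConj_iff.2 ⟨k, rfl⟩)⟩
    simp only [hχ', this]
  have eval : ∀ f : G' → F, IsCentral f → pairing χ' f
      = (Nat.card G' : F)⁻¹ * ((Finset.univ.filter fun g => IsConj a⁻¹ g).card * f a) := by
    intro f hf
    unfold pairing conj
    rw [finsum_eq_sum_of_fintype]
    congr 1
    rw [← nsmul_eq_mul, ← Finset.sum_const, Finset.sum_filter]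
    refine Finset.sum_congr rfl fun g _ => ?_
    by_cases q : IsConj a⁻¹ g
    · obtain ⟨c, hcc⟩ := isConj_iff.1 q
      have : g⁻¹ = c * a * c⁻¹ := by rw [← hcc]; group
      simp only [hχ', if_pos q, this, hf a c, one_mul]
    · simp only [hχ', if_neg q, zero_mul]
  have h1 := (h χ' hc).trans (pairing_pushforward α χ χ' hc).symm
  rw [eval ψ hψ, eval _ hp] at h1
  have hcard : ((Finset.univ.filter fun g => IsConj a⁻¹ g).card : F) ≠ 0 := by
    have : a⁻¹ ∈ Finset.univ.filter fun g => IsConj a⁻¹ g :=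
      Finset.mem_filter.2 ⟨Finset.mem_univ _, IsConj.refl _⟩
    exact_mod_cast (Finset.card_pos.2 ⟨_, this⟩).ne'
  exact mul_left_cancel₀ hcard (mul_left_cancel₀ (inv_ne_zero hG') h1)

end CentralFunctions

/-! ### The function `bAr_n` on the group of `n`-th roots of unity -/

/-- The algebraic closure of `ℚ` in which the characters take their values. -/
abbrev Qalg : Type := AlgebraicClosure ℚ

/-- `bAr_n = n⁻¹ ∑_{r=0}^{n-1} r χ_r` on `μ_n`, where `χ_r(ζ) = ζ ^ r`. -/
def bArRoots (n : ℕ) (ζ : rootsOfUnity n Qalg) : Qalg :=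
  (n : Qalg)⁻¹ * ∑ r ∈ Finset.range n, (r : Qalg) * ((ζ : Qalgˣ) : Qalg) ^ r

/-! ### Integers in algebraic extensions and ramification groups -/

section Ramification

variable (K : Type*) [NontriviallyNormedField K] [IsUltrametricDist K] [CompleteSpace K]

/-- The valuation ring of an algebraic extension `E` of the complete field `K`, with respect to the
unique extension (the spectral norm) of the absolute value of `K`. -/
def integers (E : Type*) [Field E] [Algebra K E] [Algebra.IsAlgebraic K E] :
    ValuationSubring E where
  carrier := {x | spectralMulAlgNorm K E x ≤ 1}
  mul_mem' {a b} ha hb := by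
    simp only [Set.mem_ofPred_eq, map_mul] at *
    exact mul_le_one₀ ha (apply_nonneg _ _) hb
  one_mem' := by simp
  add_mem' {a b} ha hb := by
    have h : spectralNorm K E (a + b) ≤ _ := isNonarchimedean_spectralNorm a b
    exact h.trans (max_le ha hb)
  zero_mem' := by simp
  neg_mem' {a} ha := by simpa using ha
  mem_or_inv_mem' x := by
    rcases le_total (spectralMulAlgNorm K E x) 1 with h | h
    · exact Or.inl h
    · right
      by_cases hx : x = 0
      · simp [hx]
      have h1 : spectralMulAlgNorm K E x * spectralMulAlgNorm K E x⁻¹ = 1 := by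
        rw [← map_mul, mul_inv_cancel₀ hx, map_one]
      have h2 : 0 ≤ spectralMulAlgNorm K E x⁻¹ := apply_nonneg _ _
      change spectralMulAlgNorm K E x⁻¹ ≤ 1
      nlinarith

theorem mem_integers_iff {E : Type*} [Field E] [Algebra K E] [Algebra.IsAlgebraic K E] (x : E) :
    x ∈ integers K E ↔ spectralNorm K E x ≤ 1 := Iff.rfl

variable (L : Type*) [Field L] [Algebra K L] [Algebra.IsAlgebraic K L]

/-- The action of `Gal(L/K)` on the valuation ring of `L`. -/
instance : MulSemiringAction (L ≃ₐ[K] L) (integers K L) where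
  smul σ x := ⟨σ x, by
    rw [mem_integers_iff, ← spectralNorm_eq_of_equiv]
    exact x.2⟩
  one_smul _ := rfl
  mul_smul _ _ _ := rfl
  smul_zero σ := Subtype.ext (map_zero σ)
  smul_add σ x y := Subtype.ext (map_add σ (x : L) (y : L))
  smul_one σ := Subtype.ext (map_one σ)
  smul_mul σ x y := Subtype.ext (map_mul σ (x : L) (y : L))

theorem coe_smul_integers (σ : L ≃ₐ[K] L) (x : integers K L) :
    ((σ • x : integers K L) : L) = σ x := rfl

/-- The ramification group `Γ_i`, `i ≥ 0`, in the lower numbering: the automorphisms in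
`Γ = Gal(L/K)` which act trivially on the valuation ring of `L` modulo the `(i+1)`-st power of its
maximal ideal. -/
def ramGroup (i : ℕ) : Subgroup (L ≃ₐ[K] L) :=
  ((IsLocalRing.maximalIdeal (integers K L)) ^ (i + 1)).toAddSubgroup.inertia (L ≃ₐ[K] L)

theorem ramGroup_antitone : Antitone (ramGroup K L) := fun _ _ hij _ hσ x =>
  Ideal.pow_le_pow_right (Nat.add_le_add_right hij 1) (hσ x)

/-- The degree `n = |Γ₀/Γ₁|`, prime to the residue characteristic. -/
def tameDegree : ℕ := (ramGroup K L 1).relIndex (ramGroup K L 0)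

/-- The maximal tamely ramified subextension `K^t = L^{Γ₁}` of `L/K`. -/
def tameField : IntermediateField K L := IntermediateField.fixedField (ramGroup K L 1)

/-- A uniformizer of `E`: a generator of the maximal ideal of its valuation ring. -/
def IsUniformizer (E : Type*) [Field E] [Algebra K E] [Algebra.IsAlgebraic K E]
    (π : integers K E) : Prop :=
  IsLocalRing.maximalIdeal (integers K E) = Ideal.span {π}

/-- The Artin character
`Ar_{L/K} = ∑_{i ≥ 0} [Γ₀ : Γ_i]⁻¹ Ind_{Γ_i}^Γ u_{Γ_i}`. All but finitely many summands vanish. -/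
def artinChar : (L ≃ₐ[K] L) → Qalg :=
  ∑ᶠ i : ℕ, ((ramGroup K L i).relIndex (ramGroup K L 0) : Qalg)⁻¹ •
    pushforward (ramGroup K L i).subtype (augChar (ramGroup K L i) Qalg)

end Ramification

/-! ### The refined Artin character -/

section Refined

variable (K : Type*) [NontriviallyNormedField K] [IsUltrametricDist K] [CompleteSpace K]
  (Kalg : Type*) [Field Kalg] [Algebra K Kalg] [Algebra.IsAlgebraic K Kalg]

/-- The residue field of the algebraic closure `Kalg` of `K`; it contains the residue fields of all
subextensions. -/
abbrev ResidueAlg : Type _ := IsLocalRing.ResidueField (integers K Kalg)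

instance instCharPResidueAlg (p : ℕ) [Fact p.Prime] [CharP K p] : CharP (ResidueAlg K Kalg) p := by
  have : CharP Kalg p := charP_of_injective_algebraMap (algebraMap K Kalg).injective p
  have h0 : (p : integers K Kalg) = 0 := Subtype.ext (by simp)
  have h1 : (p : ResidueAlg K Kalg) = 0 := by
    rw [← map_natCast (IsLocalRing.residue (integers K Kalg)), h0, map_zero]
  exact CharP.ringChar_of_prime_eq_zero Fact.out h1 ▸ inferInstance

/-- The choice of an embedding of `Qalg`: into `Kalg` if `K` has characteristic zero, and otherwise
into an algebraic closure of the fraction field of the ring of Witt vectors of the residue field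
of `Kalg` (equivalently: into the algebraic closure, inside the latter field, of the fraction field
of the Witt vectors of the residue field of `K`). -/
inductive RootEmbedding : Type _
  | charZero [CharZero K] (j : Qalg →+* Kalg) : RootEmbedding
  | charP (p : ℕ) [Fact p.Prime] [CharP K p]
      (j : Qalg →+* AlgebraicClosure (FractionRing (WittVector p (ResidueAlg K Kalg)))) :
      RootEmbedding

variable {K Kalg}

/-- `e.Corresponds ζ x`: the root of unity `ζ` of `Qalg` is, via the embedding `e`, the Teichmüller
lift of the root of unity `x` of the residue field of `Kalg`. In characteristic zero, for `ζ` of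
order prime to the residue characteristic, this means that `x` is the residue class of the image
of `ζ`. -/
def RootEmbedding.Corresponds : RootEmbedding K Kalg → Qalg → ResidueAlg K Kalg → Prop
  | @RootEmbedding.charZero _ _ _ _ _ _ _ _ _ j, ζ, x => ∃ h : j ζ ∈ integers K Kalg,
      IsLocalRing.residue (integers K Kalg) ⟨j ζ, h⟩ = x
  | @RootEmbedding.charP _ _ _ _ _ _ _ _ p _ _ j, ζ, x => j ζ = algebraMap (FractionRing (WittVector p (ResidueAlg K Kalg))) _
      (algebraMap (WittVector p (ResidueAlg K Kalg)) _ (WittVector.teichmuller p x))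

variable (e : RootEmbedding K Kalg) (L : IntermediateField K Kalg)

/-- The homomorphism `Γ₀ → Γ₀/Γ₁ ≅ μ_n`, where the isomorphism is `Ψ_{L/K}`: the image of `σ` is
the unique `n`-th root of unity in `Qalg` that corresponds to the residue class of `σ(π)/π`, for
any uniformizer `π` of the maximal tamely ramified subextension of `L/K`. -/
def tameChar (σ : ramGroup K L 0) : rootsOfUnity (tameDegree K L) Qalg :=
  Classical.epsilon fun ζ => ∃ π : integers K (tameField K L), IsUniformizer K (tameField K L) π ∧
    ∃ u : integers K Kalg,
      (u : Kalg) * (((π : tameField K L) : L) : Kalg) = ((σ : L ≃ₐ[K] L) (π : tameField K L) : L) ∧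
      e.Corresponds ((ζ : Qalgˣ) : Qalg) (IsLocalRing.residue (integers K Kalg) u)

/-- The inflation `Inf (Ψ_{L/K}^* bAr_n)` of the tame part of the refined Artin character to the
inertia group `Γ₀`. -/
def bArTame : ramGroup K L 0 → Qalg := fun σ => bArRoots (tameDegree K L) (tameChar e L σ)

/-- `Ind_{Γ_i}^{Γ₀} u_{Γ_i}`. -/
def inducedAug (K : Type*) [NontriviallyNormedField K] [IsUltrametricDist K] [CompleteSpace K]
    (L : Type*) [Field L] [Algebra K L] [Algebra.IsAlgebraic K L] (i : ℕ) :
    ramGroup K L 0 → Qalg :=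
  pushforward (Subgroup.inclusion (ramGroup_antitone K L (Nat.zero_le i)))
    (augChar (ramGroup K L i) Qalg)

/-- The refined Artin character
`bAr_{L/K} = Ind_{Γ₀}^Γ (Inf bAr^t_{L/K} + ½ Ind_{Γ₁}^{Γ₀} u_{Γ₁}
  + ½ ∑_{i ≥ 1} [Γ₀ : Γ_i]⁻¹ Ind_{Γ_i}^{Γ₀} u_{Γ_i})`.
All but finitely many summands vanish. -/
def refinedArtinChar : (L ≃ₐ[K] L) → Qalg :=
  pushforward (ramGroup K L 0).subtype
    (bArTame e L + (1 / 2 : Qalg) • inducedAug K L 1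
      + (1 / 2 : Qalg) • ∑ᶠ i : ℕ, ((ramGroup K L (i + 1)).relIndex (ramGroup K L 0) : Qalg)⁻¹ •
          inducedAug K L (i + 1))

end Refined

/-! ### Distributions on locally constant central functions -/

section Distributions

/-- The space of locally constant central `F`-valued functions on a topological group. -/
def LocConstCentral (G F : Type*) [Group G] [TopologicalSpace G] [Field F] :
    Submodule F (G → F) where
  carrier := {f | IsLocallyConstant f ∧ IsCentral f}
  add_mem' {f g} hf hg := ⟨hf.1.add hg.1, fun a b => by simp [hf.2 a b, hg.2 a b]⟩
  zero_mem' := ⟨IsLocallyConstant.const 0, fun _ _ => rfl⟩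
  smul_mem' c f hf := ⟨hf.1.comp (c • ·), fun a b => by simp [hf.2 a b]⟩

/-- A distribution: a linear form on the space of locally constant central functions. -/
abbrev Distribution (G F : Type*) [Group G] [TopologicalSpace G] [Field F] : Type _ :=
  LocConstCentral G F →ₗ[F] F

variable {G F : Type*} [Group G] [TopologicalSpace G] [IsTopologicalGroup G] [Field F]

/-- Conjugation `f ↦ (g ↦ f(g⁻¹))` of locally constant central functions. -/
def LocConstCentral.conj : LocConstCentral G F →ₗ[F] LocConstCentral G F where
  toFun f := ⟨RefinedArtin.conj f.1, f.2.1.comp_continuous continuous_inv, fun a b => by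
    have h := f.2.2 a⁻¹ b
    simpa [RefinedArtin.conj, mul_assoc] using h⟩
  map_add' _ _ := rfl
  map_smul' _ _ := rfl

/-- The conjugate distribution `f ↦ D(f̄)`. As `(χ̄ | f) = (χ | f̄)` on a finite group, this is the
distribution that is defined by the conjugates of the functions defining `D`. -/
def Distribution.conj (D : Distribution G F) : Distribution G F :=
  D ∘ₗ LocConstCentral.conj

variable {K Kalg : Type*} [Field K] [Field Kalg] [Algebra K Kalg]

/-- The restriction homomorphism `Gal(L/K) → Gal(M/K)`, for `M ⊆ L`. -/
def restrictHom {M L : FiniteGaloisIntermediateField K Kalg} (h : M ≤ L) :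
    (L ≃ₐ[K] L) →* (M ≃ₐ[K] M) :=
  letI : Algebra M L := RingHom.toAlgebra (IntermediateField.inclusion h)
  haveI : IsScalarTower K M L := IsScalarTower.of_algebraMap_eq (congrFun rfl)
  AlgEquiv.restrictNormalHom M

theorem coe_restrictHom {M L : FiniteGaloisIntermediateField K Kalg} (h : M ≤ L)
    (σ : L ≃ₐ[K] L) (x : M) :
    ((restrictHom h σ x : M) : Kalg) = (σ (IntermediateField.inclusion h x) : L) := by
  let : Algebra M L := RingHom.toAlgebra (IntermediateField.inclusion h)
  have : IsScalarTower K M L := IsScalarTower.of_algebraMap_eq (congrFun rfl)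
  exact congrArg (Subtype.val) (AlgEquiv.restrictNormal_commutes σ M x)

/-- The distribution `D` on the locally constant central functions on `Gal(Kalg/K)` is the one
defined by the system `χ` of functions on the groups `Gal(L/K)`: if `f` is the inflation of a
function `φ` on `Gal(L/K)`, then `D(f) = (χ_L | φ)`. -/
def Distribution.IsDefinedBy [Algebra Qalg F] (D : Distribution (Kalg ≃ₐ[K] Kalg) F)
    (χ : ∀ L : FiniteGaloisIntermediateField K Kalg, (L ≃ₐ[K] L) → Qalg) : Prop :=
  ∀ (L : FiniteGaloisIntermediateField K Kalg) (φ : (L ≃ₐ[K] L) → F)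
    (f : LocConstCentral (Kalg ≃ₐ[K] Kalg) F),
    (∀ σ : Kalg ≃ₐ[K] Kalg, f.1 σ = φ (AlgEquiv.restrictNormalHom L σ)) →
      D f = pairing (fun g => algebraMap Qalg F (χ L g)) φ

end Distributions

end RefinedArtin

end

/-!
# Refined Artin characters

The whole statement follows from a formula for `bAr_{L/K}`. On `μ_n` one has
`bAr_n(ζ) = bArOdd ζ + (n/2) δ_1(ζ) - 1/2`, where `bArOdd ζ = (ζ - 1)⁻¹ + 1/2` for `ζ ≠ 1` and
`bArOdd 1 = 0` (`bArRoots_eq`). The even part of `bAr_n ∘ ψ_{L/K}` thus completes the two wild terms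
to half of the Artin character `a_L` of the inertia group `Γ₀`, so that `bAr_{L/K}` is induced from
the function `bArOdd ∘ ψ_{L/K} + a_L / 2` on `Γ₀`, and `Ar_{L/K}` from `a_L` (`refinedArtinChar_eq`,
`artinChar_eq`).

* Since `bArOdd` is odd and `a_L` is even, `Ar_{L/K}` is the sum of `bAr_{L/K}` and its conjugate.

* For a subextension `M` the map `Γ₀(L/K) → Γ₀(M/K)` is onto, and by functoriality of pushforward it
  suffices to push the two terms forward along it.

  The sum of `a_L` over `Γ₀` vanishes, and off `1` its value is `-depth σ`, where `depth σ` is the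
  normalized value of `σ π - π` for a prime element `π` of `L`. So `a_L` is compatible because
  `∏ |σ h π - π| = |σ ϖ - ϖ|`, where `h` runs through the inertia group of `L/M` and `ϖ` is a prime
  element of `M` (`prod_specNorm_apply_sub`). The proof takes the characteristic polynomial of `π`
  over the maximal unramified subextension of `L/M`; its constant term is a prime element there.
  This uses that the ramification index of `L/M` is the order of the inertia group
  (`specNorm_prime_fixedField`), and that residue classes have good representatives fixed by inertia
  (`exists_fixed_sub_lt_one`), which is where the residue field has to be perfect.

  For the tame term, `ψ_{M/K} = ψ_{L/K}^k` with `k` the tame part of the ramification index of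
  `L/M`, and `ψ_{L/K}` maps the fibre over `1` onto `μ_k`; the average of `bArOdd` over a coset `ζ μ_k` is
  `bArOdd (ζ ^ k)` (`average_bArOdd`).

* A locally constant function on `Gal(K^alg/K)` comes from a finite Galois extension, as the Galois
  group of the separable closure is compact (`exists_finiteGalois_factor`). A compatible system of
  functions therefore defines exactly one distribution (`existsUnique_isDefinedBy`).

All absolute values are taken in the form of the spectral norm of `L/K`.
-/

set_option linter.unusedSectionVars false

noncomputable section

namespace RefinedArtin

/-! ### Pushforward of functions on finite groups -/

section Pushforward

variable {G G' G'' F : Type*} [Group G] [Group G'] [Group G''] [Field F]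

theorem IsCentral.comp_hom {X : Type*} {f : G' → X} (hf : IsCentral f) (α : G →* G') :
    IsCentral (f ∘ α) := fun g h => by simp [hf (α g) (α h)]

theorem pairing_comm [Finite G] (χ₁ χ₂ : G → F) : pairing χ₁ χ₂ = pairing χ₂ χ₁ := by
  have := Fintype.ofFinite G
  unfold pairing conj
  rw [finsum_eq_sum_of_fintype, finsum_eq_sum_of_fintype,
    ← Equiv.sum_comp (Equiv.inv G) fun g => χ₂ g * χ₁ g⁻¹]
  simp [mul_comm]

theorem pairing_add [Finite G] (χ φ₁ φ₂ : G → F) :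
    pairing χ (φ₁ + φ₂) = pairing χ φ₁ + pairing χ φ₂ := by
  have := Fintype.ofFinite G
  simp [pairing, conj, finsum_eq_sum_of_fintype, mul_add, Finset.sum_add_distrib]

theorem pairing_smul [Finite G] (c : F) (χ φ : G → F) :
    pairing χ (c • φ) = c * pairing χ φ := by
  have := Fintype.ofFinite G
  simp only [pairing, conj, finsum_eq_sum_of_fintype, Pi.smul_apply, smul_eq_mul]
  rw [mul_left_comm, Finset.mul_sum _ _ c]
  congr 1
  exact Finset.sum_congr rfl fun g _ => by ring

theorem pairing_conj [Finite G] (χ φ : G → F) : pairing χ (conj φ) = pairing (conj χ) φ := by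
  have := Fintype.ofFinite G
  unfold pairing conj
  rw [finsum_eq_sum_of_fintype, finsum_eq_sum_of_fintype,
    ← Equiv.sum_comp (Equiv.inv G) fun g => χ g⁻¹ * φ g⁻¹]
  simp

theorem pairing_one [Finite G] (χ : G → F) :
    pairing 1 χ = (Nat.card G : F)⁻¹ * ∑ᶠ g, χ g := by
  have := Fintype.ofFinite G
  unfold pairing conj
  rw [finsum_eq_sum_of_fintype, finsum_eq_sum_of_fintype, ← Equiv.sum_comp (Equiv.inv G) χ]
  simp

/-- Pushforward is functorial. -/
theorem pushforward_pushforward [Finite G] [Finite G'] [Finite G''] [CharZero F]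
    (β : G' →* G'') (α : G →* G') (χ : G → F) :
    pushforward β (pushforward α χ) = pushforward (β.comp α) χ := by
  refine eq_pushforward _ _ _ (isCentral_pushforward _ _) fun χ' h => ?_
  rw [pairing_pushforward _ _ _ h, pairing_pushforward _ _ _ (h.comp_hom β)]
  rfl

theorem pushforward_apply [Fintype G] [Fintype G'] [DecidableEq G'] (α : G →* G') (χ : G → F)
    (g' : G') : pushforward α χ g' = (Nat.card G : F)⁻¹ *
      ∑ x : G', ∑ g : G, if α g = x * g' * x⁻¹ then χ g else 0 := by
  simp only [pushforward, finsum_eq_sum_of_fintype, finsum_eq_if]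

theorem pushforward_add [Finite G] [Finite G'] (α : G →* G') (χ₁ χ₂ : G → F) :
    pushforward α (χ₁ + χ₂) = pushforward α χ₁ + pushforward α χ₂ := by
  classical
  have := Fintype.ofFinite G
  have := Fintype.ofFinite G'
  ext g'
  simp only [pushforward_apply, Pi.add_apply, ← mul_add, ← Finset.sum_add_distrib]
  congr 1
  refine Finset.sum_congr rfl fun x _ => Finset.sum_congr rfl fun g _ => ?_
  split_ifs <;> simp

theorem pushforward_smul [Finite G] [Finite G'] (α : G →* G') (c : F) (χ : G → F) :
    pushforward α (c • χ) = c • pushforward α χ := by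
  classical
  have := Fintype.ofFinite G
  have := Fintype.ofFinite G'
  ext g'
  simp only [pushforward_apply, Pi.smul_apply, smul_eq_mul]
  rw [mul_left_comm, Finset.mul_sum _ _ c]
  congr 2
  ext x
  rw [Finset.mul_sum]
  exact Finset.sum_congr rfl fun g _ => by split_ifs <;> simp

theorem pushforward_zero [Finite G] [Finite G'] (α : G →* G') :
    pushforward α (0 : G → F) = 0 := by
  simpa using pushforward_smul α (0 : F) (0 : G → F)

theorem pushforward_sum [Finite G] [Finite G'] {ι : Type*} (α : G →* G') (s : Finset ι)
    (χ : ι → G → F) : pushforward α (∑ i ∈ s, χ i) = ∑ i ∈ s, pushforward α (χ i) := by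
  classical
  induction s using Finset.induction_on with
  | empty => simp [pushforward_zero]
  | insert a s ha ih => rw [Finset.sum_insert ha, Finset.sum_insert ha, pushforward_add, ih]

/-- Pushforward commutes with `χ ↦ χ̄`. -/
theorem pushforward_conj [Finite G] [Finite G'] (α : G →* G') (χ : G → F) :
    pushforward α (conj χ) = conj (pushforward α χ) := by
  classical
  have := Fintype.ofFinite G
  have := Fintype.ofFinite G'
  ext g'
  simp only [conj, pushforward_apply]
  congr 2
  ext x
  rw [← Equiv.sum_comp (Equiv.inv G)]
  refine Finset.sum_congr rfl fun g _ => ?_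
  have : (α g)⁻¹ = x * g' * x⁻¹ ↔ α g = x * g'⁻¹ * x⁻¹ := by
    rw [inv_eq_iff_eq_inv]; simp [mul_assoc]
  simp [this]

/-- The pushforward of a central function along a surjection averages over the fibres. -/
theorem pushforward_of_surjective [Finite G] [Finite G'] [CharZero F] (α : G →* G')
    (hα : Function.Surjective α) {χ : G → F} (hχ : IsCentral χ) (g : G) :
    pushforward α χ (α g) = (Nat.card α.ker : F)⁻¹ * ∑ᶠ k : α.ker, χ (g * k) := by
  classical
  have := Fintype.ofFinite G
  have := Fintype.ofFinite G'
  have key : ∀ x : G', ∑ g₁ : G, (if α g₁ = x * α g * x⁻¹ then χ g₁ else 0)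
      = ∑ k : α.ker, χ (g * k) := by
    intro x
    obtain ⟨y, rfl⟩ := hα x
    rw [← Finset.sum_filter]
    symm
    refine Finset.sum_bij (fun k _ => y * (g * k) * y⁻¹) ?_ ?_ ?_ ?_
    · intro k _
      simp [MonoidHom.mem_ker.1 k.2]
    · intro k _ l _ h
      simpa using h
    · intro b hb
      simp only [Finset.mem_filter, Finset.mem_univ, true_and] at hb
      refine ⟨⟨g⁻¹ * (y⁻¹ * b * y), ?_⟩, Finset.mem_univ _, by simp [mul_assoc]⟩
      rw [MonoidHom.mem_ker]
      simp [hb, mul_assoc]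
    · intro k _
      rw [hχ]
  have hcard : (Nat.card G : F) = Nat.card G' * Nat.card α.ker := by
    rw [← Nat.cast_mul, Subgroup.card_eq_card_quotient_mul_card_subgroup α.ker,
      Nat.card_congr (QuotientGroup.quotientKerEquivOfSurjective α hα).toEquiv]
  have hG' : (Nat.card G' : F) ≠ 0 := by exact_mod_cast Nat.card_pos.ne'
  rw [pushforward_apply, finsum_eq_sum_of_fintype]
  simp_rw [key]
  rw [Finset.sum_const, Finset.card_univ, ← Nat.card_eq_fintype_card, nsmul_eq_mul, hcard]
  field_simp

/-- Pushforward preserves the multiplicity of the trivial character. -/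
theorem pushforward_sum_eq_zero [Finite G] [Finite G'] [CharZero F] (α : G →* G')
    {χ : G → F} (hχ : ∑ᶠ g, χ g = 0) : ∑ᶠ g, pushforward α χ g = 0 := by
  have h := pairing_pushforward α χ 1 fun _ _ => rfl
  have h1 : ((1 : G' → F) ∘ α) = 1 := rfl
  have hG' : (Nat.card G' : F) ≠ 0 := by exact_mod_cast Nat.card_pos.ne'
  rw [h1, pairing_one, pairing_one, hχ, mul_zero] at h
  exact (mul_eq_zero.1 h).resolve_left (inv_ne_zero hG')

/-- Two functions that agree off `1` and have the same sum are equal. -/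
theorem eq_of_forall_ne_one [Finite G] {χ₁ χ₂ : G → F} (h : ∀ g ≠ 1, χ₁ g = χ₂ g)
    (hs : ∑ᶠ g, χ₁ g = ∑ᶠ g, χ₂ g) : χ₁ = χ₂ := by
  classical
  have := Fintype.ofFinite G
  ext g
  by_cases hg : g = 1
  · subst hg
    rw [finsum_eq_sum_of_fintype, finsum_eq_sum_of_fintype,
      ← Finset.add_sum_erase _ _ (Finset.mem_univ 1),
      ← Finset.add_sum_erase _ χ₂ (Finset.mem_univ 1),
      Finset.sum_congr rfl fun x hx => h x (Finset.ne_of_mem_erase hx)] at hs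
    exact add_right_cancel hs
  · exact h g hg

theorem sum_augChar [Finite G] : ∑ᶠ g, augChar G F g = 0 := by
  classical
  have := Fintype.ofFinite G
  simp [augChar, regularChar, finsum_eq_sum_of_fintype]

/-- The character induced by the augmentation character of a normal subgroup. -/
theorem pushforward_augChar [Finite G] [Finite G'] [CharZero F] (ι : G →* G')
    (hι : Function.Injective ι) (hn : ι.range.Normal) (g : G') :
    pushforward ι (augChar G F) g = open Classical in
      (if g = 1 then (Nat.card G' : F) else 0) -
        (if g ∈ ι.range then (Nat.card G' : F) / Nat.card G else 0) := by
  classical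
  have := Fintype.ofFinite G
  have := Fintype.ofFinite G'
  have hG : (Nat.card G : F) ≠ 0 := by exact_mod_cast Nat.card_pos.ne'
  rw [pushforward_apply]
  by_cases hg : g ∈ ι.range
  · have key : ∀ x : G', ∑ n : G, (if ι n = x * g * x⁻¹ then augChar G F n else 0)
        = (if g = 1 then (Nat.card G : F) else 0) - 1 := by
      intro x
      obtain ⟨n, hn⟩ := hn.conj_mem g hg x
      rw [Finset.sum_eq_single n]
      · rw [if_pos hn]
        have : n = 1 ↔ g = 1 := by
          rw [← map_eq_one_iff ι hι, hn]
          simp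
        simp [augChar, regularChar, this]
      · intro b _ hb
        rw [if_neg]
        rw [← hn]
        exact fun h => hb (hι h)
      · simp
    simp_rw [key]
    rw [Finset.sum_const, Finset.card_univ, ← Nat.card_eq_fintype_card, nsmul_eq_mul, if_pos hg]
    split_ifs
    · field_simp
    · field_simp
      ring
  · have hg1 : g ≠ 1 := fun h => hg (h ▸ one_mem _)
    rw [if_neg hg, if_neg hg1, sub_zero]
    rw [Finset.sum_eq_zero, mul_zero]
    intro x _
    refine Finset.sum_eq_zero fun n _ => if_neg fun h => hg ?_
    have := hn.conj_mem (ι n) ⟨n, rfl⟩ x⁻¹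
    rw [h] at this
    simpa [mul_assoc] using this

end Pushforward

/-! ### The odd part of the functions `bAr_n` -/

/-- The function `ζ ↦ (ζ - 1)⁻¹ + ½`, extended by `0` to `ζ = 1`. On `μ_n` it is the odd part of
`bAr_n`; it does not depend on `n`. -/
def bArOdd (ζ : Qalg) : Qalg := open Classical in if ζ = 1 then 0 else (ζ - 1)⁻¹ + 1 / 2

theorem bArOdd_one : bArOdd 1 = 0 := by simp [bArOdd]

theorem bArOdd_inv {ζ : Qalg} (h0 : ζ ≠ 0) : bArOdd ζ⁻¹ = -bArOdd ζ := by
  unfold bArOdd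
  by_cases h : ζ = 1
  · simp [h]
  · have h1 : ζ - 1 ≠ 0 := sub_ne_zero.2 h
    have h2 : 1 - ζ ≠ 0 := sub_ne_zero.2 (Ne.symm h)
    rw [if_neg h, if_neg (by simpa using h)]
    have : ζ⁻¹ - 1 = (1 - ζ) / ζ := by field_simp
    rw [this, inv_div]
    have h3 : ζ / (1 - ζ) = - (ζ / (ζ - 1)) := by rw [← neg_sub ζ 1, div_neg]
    rw [h3]
    field_simp
    ring

theorem sum_range_mul_pow {n : ℕ} {ζ : Qalg} (h : ζ ^ n = 1) (h1 : ζ ≠ 1) :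
    ∑ r ∈ Finset.range n, (r : Qalg) * ζ ^ r = n * (ζ - 1)⁻¹ := by
  have h2 : ζ - 1 ≠ 0 := sub_ne_zero.2 h1
  have key : ∀ m : ℕ, (ζ - 1) * ∑ r ∈ Finset.range m, (r : Qalg) * ζ ^ r
      = m * ζ ^ m - ζ * ∑ r ∈ Finset.range m, ζ ^ r := by
    intro m
    induction m with
    | zero => simp
    | succ m ih =>
      rw [Finset.sum_range_succ, Finset.sum_range_succ, mul_add, ih]
      push_cast
      ring
  have hg : ∑ r ∈ Finset.range n, ζ ^ r = 0 := by
    have := geom_sum_mul ζ n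
    rw [h, sub_self] at this
    exact (mul_eq_zero.1 this).resolve_right h2
  have := key n
  rw [hg, h, mul_zero, sub_zero, mul_one] at this
  rw [← this]
  field_simp

theorem bArRoots_eq {n : ℕ} (hn : n ≠ 0) (ζ : rootsOfUnity n Qalg) :
    bArRoots n ζ = open Classical in
      bArOdd ((ζ : Qalgˣ) : Qalg) + (if ζ = 1 then (n : Qalg) / 2 else 0) - 1 / 2 := by
  have hn' : (n : Qalg) ≠ 0 := by exact_mod_cast hn
  have hc : (((ζ : Qalgˣ) : Qalg) = 1) ↔ ζ = 1 := by simp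
  unfold bArRoots
  by_cases h : ζ = 1
  · subst h
    have : (∑ i ∈ Finset.range n, (i : Qalg)) = n * (n - 1) / 2 := by
      rw [eq_div_iff two_ne_zero]
      have h2 := congrArg (Nat.cast : ℕ → Qalg) (Finset.sum_range_id_mul_two n)
      rw [Nat.cast_mul, Nat.cast_sum, Nat.cast_mul, Nat.cast_pred (Nat.pos_of_ne_zero hn)] at h2
      exact_mod_cast h2
    simp only [OneMemClass.coe_one, Units.val_one, one_pow, mul_one, this, bArOdd_one, if_true]
    field_simp
    ring
  · have h1 : ((ζ : Qalgˣ) : Qalg) ^ n = 1 := by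
      have := ζ.2
      rw [mem_rootsOfUnity] at this
      simpa using congrArg Units.val this
    rw [sum_range_mul_pow h1 (fun h' => h (hc.1 h')), bArOdd, if_neg (fun h' => h (hc.1 h')),
      if_neg h]
    field_simp
    ring

/-- If a character `ψ` of a finite group `H` has image `μ_k`, the average of `bArOdd` over the
coset `ζ • ψ(H)` is its value at `ζ ^ k`. -/
theorem average_bArOdd {H : Type*} [Group H] [Finite H] (ψ : H →* Qalg) {k : ℕ}
    (hk : ∀ h, ψ h ^ k = 1) (hk' : ∀ j, 0 < j → j < k → ∃ h, ψ h ^ j ≠ 1) {ζ : Qalg}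
    (hζ : ζ ≠ 0) (hk0 : k ≠ 0) :
    (Nat.card H : Qalg)⁻¹ * ∑ᶠ h, bArOdd (ζ * ψ h) = bArOdd (ζ ^ k) := by
  classical
  have := Fintype.ofFinite H
  have hψ0 : ∀ h, ψ h ≠ 0 := fun h e => by
    have := hk h
    rw [e, zero_pow hk0] at this
    exact zero_ne_one this
  have hH : (Nat.card H : Qalg) ≠ 0 := by exact_mod_cast Nat.card_pos.ne'
  have hsum : ∀ j, 0 < j → j < k → ∑ h, ψ h ^ j = 0 := by
    intro j hj hjk
    have := sum_hom_units_eq_zero ((powMonoidHom j).comp ψ) (by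
      obtain ⟨h, hh⟩ := hk' j hj hjk
      exact fun e => hh (DFunLike.congr_fun e h))
    simpa using this
  rw [finsum_eq_sum_of_fintype]
  by_cases h1 : ζ ^ k = 1
  · -- The coset is `ψ(H)` itself: `ζ` is a value of `ψ`, and `bArOdd` is odd.
    have hex : ∃ h, ψ h = ζ := by
      by_contra hne
      push Not at hne
      -- `∑_{j<k} ζ^{-j} ψ(h)^j` vanishes for each `h`, but the sum over `h` is `|H|`.
      have hz : ∀ h, ∑ j ∈ Finset.range k, (ζ⁻¹ * ψ h) ^ j = 0 := by
        intro h
        have := geom_sum_mul (ζ⁻¹ * ψ h) k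
        rw [mul_pow, inv_pow, h1, hk, inv_one, one_mul, sub_self] at this
        refine (mul_eq_zero.1 this).resolve_right fun e => hne h ?_
        have e' := sub_eq_zero.1 e
        field_simp at e'
        exact e'
      have hs := Finset.sum_eq_zero (s := Finset.univ) fun h _ => hz h
      rw [Finset.sum_comm, Finset.sum_eq_single 0] at hs
      · simp at hs
      · intro j hj hj0
        simp_rw [mul_pow]
        rw [← Finset.mul_sum, hsum j (Nat.pos_of_ne_zero hj0) (Finset.mem_range.1 hj), mul_zero]
      · simp [hk0]
    obtain ⟨h₀, rfl⟩ := hex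
    have e1 : ∑ h, bArOdd (ψ h₀ * ψ h) = ∑ h, bArOdd (ψ h) := by
      rw [← Equiv.sum_comp (Equiv.mulLeft h₀) fun h => bArOdd (ψ h)]
      simp
    have e2 : ∑ h, bArOdd (ψ h) = -∑ h, bArOdd (ψ h) := by
      conv_lhs => rw [← Equiv.sum_comp (Equiv.inv H) fun h => bArOdd (ψ h)]
      rw [← Finset.sum_neg_distrib]
      refine Finset.sum_congr rfl fun h _ => ?_
      rw [← bArOdd_inv (hψ0 h)]
      congr 1
      refine eq_inv_of_mul_eq_one_left ?_
      rw [← map_mul]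
      simp
    have e3 : ∑ h, bArOdd (ψ h) = 0 := self_eq_neg.1 e2
    rw [e1, e3, h1, bArOdd_one, mul_zero]
  · have hne : ∀ h, ζ * ψ h ≠ 1 := fun h e => h1 (by
      have := congrArg (· ^ k) e
      simpa [mul_pow, hk] using this)
    have hval : ∀ h, bArOdd (ζ * ψ h)
        = (ζ ^ k - 1)⁻¹ * ∑ j ∈ Finset.range k, (ζ * ψ h) ^ j + 1 / 2 := by
      intro h
      have h3 : ζ * ψ h - 1 ≠ 0 := sub_ne_zero.2 (hne h)
      have h4 : ζ ^ k - 1 ≠ 0 := sub_ne_zero.2 h1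
      rw [bArOdd, if_neg (hne h), add_left_inj]
      have := geom_sum_mul (ζ * ψ h) k
      rw [mul_pow ζ (ψ h) k, hk, mul_one] at this
      rw [← this]
      have h5 : ∑ j ∈ Finset.range k, (ζ * ψ h) ^ j ≠ 0 := fun e => by
        rw [e, zero_mul] at this
        exact h4 this.symm
      field_simp
    have hs : ∑ h, ∑ j ∈ Finset.range k, (ζ * ψ h) ^ j = Nat.card H := by
      rw [Finset.sum_comm, Finset.sum_eq_single 0]
      · simp
      · intro j hj hj0
        simp_rw [mul_pow]
        rw [← Finset.mul_sum, hsum j (Nat.pos_of_ne_zero hj0) (Finset.mem_range.1 hj), mul_zero]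
      · simp [hk0]
    simp_rw [hval]
    rw [Finset.sum_add_distrib, ← Finset.mul_sum, hs, bArOdd, if_neg h1, Finset.sum_const,
      Finset.card_univ, ← Nat.card_eq_fintype_card, nsmul_eq_mul]
    field_simp

/-! ### The spectral norm and prime elements of subextensions -/

section SpectralNorm

variable (K : Type*) [NontriviallyNormedField K] [IsUltrametricDist K] [CompleteSpace K]
  {L : Type*} [Field L] [Algebra K L] [Algebra.IsAlgebraic K L]

theorem specNorm_mul (x y : L) :
    spectralNorm K L (x * y) = spectralNorm K L x * spectralNorm K L y :=
  map_mul (spectralMulAlgNorm K L) x y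

theorem specNorm_pow (x : L) (n : ℕ) : spectralNorm K L (x ^ n) = spectralNorm K L x ^ n :=
  map_pow (spectralMulAlgNorm K L) x n

theorem specNorm_inv (x : L) : spectralNorm K L x⁻¹ = (spectralNorm K L x)⁻¹ :=
  map_inv₀ (spectralMulAlgNorm K L) x

theorem specNorm_div (x y : L) :
    spectralNorm K L (x / y) = spectralNorm K L x / spectralNorm K L y :=
  map_div₀ (spectralMulAlgNorm K L) x y

theorem specNorm_zpow (x : L) (n : ℤ) : spectralNorm K L (x ^ n) = spectralNorm K L x ^ n :=
  map_zpow₀ (spectralMulAlgNorm K L) x n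

theorem specNorm_prod {ι : Type*} (s : Finset ι) (f : ι → L) :
    spectralNorm K L (∏ i ∈ s, f i) = ∏ i ∈ s, spectralNorm K L (f i) :=
  map_prod (spectralMulAlgNorm K L) f s

theorem specNorm_neg (x : L) : spectralNorm K L (-x) = spectralNorm K L x :=
  map_neg_eq_map (spectralMulAlgNorm K L) x

theorem specNorm_sub_comm (x y : L) : spectralNorm K L (x - y) = spectralNorm K L (y - x) := by
  rw [← specNorm_neg, neg_sub]

theorem specNorm_add_le (x y : L) :
    spectralNorm K L (x + y) ≤ max (spectralNorm K L x) (spectralNorm K L y) :=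
  isNonarchimedean_spectralNorm x y

theorem specNorm_sub_le (x y : L) :
    spectralNorm K L (x - y) ≤ max (spectralNorm K L x) (spectralNorm K L y) := by
  rw [sub_eq_add_neg, ← specNorm_neg K y]
  exact specNorm_add_le K x (-y)

theorem specNorm_sum_le {ι : Type*} (s : Finset ι) (f : ι → L) {c : ℝ} (hc : 0 ≤ c)
    (h : ∀ i ∈ s, spectralNorm K L (f i) ≤ c) : spectralNorm K L (∑ i ∈ s, f i) ≤ c := by
  classical
  induction s using Finset.induction_on with
  | empty => simpa [spectralNorm_zero] using hc
  | insert a s ha ih =>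
    rw [Finset.sum_insert ha]
    exact (specNorm_add_le K _ _).trans (max_le (h a (Finset.mem_insert_self a s))
      (ih fun i hi => h i (Finset.mem_insert_of_mem hi)))

theorem specNorm_sum_lt {ι : Type*} (s : Finset ι) (f : ι → L) {c : ℝ} (hc : 0 < c)
    (h : ∀ i ∈ s, spectralNorm K L (f i) < c) : spectralNorm K L (∑ i ∈ s, f i) < c := by
  classical
  induction s using Finset.induction_on with
  | empty => simpa [spectralNorm_zero] using hc
  | insert a s ha ih =>
    rw [Finset.sum_insert ha]
    exact (specNorm_add_le K _ _).trans_lt (max_lt (h a (Finset.mem_insert_self a s))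
      (ih fun i hi => h i (Finset.mem_insert_of_mem hi)))

theorem specNorm_pos {x : L} (hx : x ≠ 0) : 0 < spectralNorm K L x :=
  spectralNorm_zero_lt hx (Algebra.IsAlgebraic.isAlgebraic x)

theorem specNorm_nonneg (x : L) : 0 ≤ spectralNorm K L x := spectralNorm_nonneg x

theorem specNorm_eq_zero {x : L} : spectralNorm K L x = 0 ↔ x = 0 :=
  ⟨fun h => by_contra fun hx => (specNorm_pos K hx).ne' h, fun h => h ▸ spectralNorm_zero⟩

theorem specNorm_one : spectralNorm K L 1 = 1 := spectralNorm_one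

theorem specNorm_algEquiv (σ : L ≃ₐ[K] L) (x : L) : spectralNorm K L (σ x) = spectralNorm K L x :=
  (spectralNorm_eq_of_equiv σ x).symm

theorem specNorm_eq_of_sub_lt {x y : L} (h : spectralNorm K L (x - y) < spectralNorm K L y) :
    spectralNorm K L x = spectralNorm K L y := by
  apply le_antisymm
  · have := specNorm_add_le K (x - y) y
    rw [sub_add_cancel] at this
    exact this.trans (max_le h.le le_rfl)
  · by_contra hlt
    push Not at hlt
    have := specNorm_sub_le K x (x - y)
    rw [sub_sub_cancel] at this
    exact absurd this (not_le.2 (max_lt hlt h))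

variable (L) in
/-- A prime element of an intermediate field `T` of `L/K`: an element of norm less than one whose
norm generates the group of values of `T`. -/
structure IsPrimeElt (T : IntermediateField K L) (ϖ : L) : Prop where
  mem : ϖ ∈ T
  ne_zero : ϖ ≠ 0
  lt_one : spectralNorm K L ϖ < 1
  exists_zpow : ∀ x ∈ T, x ≠ 0 → ∃ k : ℤ, spectralNorm K L x = spectralNorm K L ϖ ^ k

namespace IsPrimeElt

variable {K} {T T' : IntermediateField K L} {ϖ ϖ' : L}

theorem pos (h : IsPrimeElt K L T ϖ) : 0 < spectralNorm K L ϖ := specNorm_pos K h.ne_zero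

theorem exists_pow (h : IsPrimeElt K L T ϖ) {x : L} (hx : x ∈ T) (hx0 : x ≠ 0)
    (h1 : spectralNorm K L x ≤ 1) : ∃ k : ℕ, spectralNorm K L x = spectralNorm K L ϖ ^ k := by
  obtain ⟨k, hk⟩ := h.exists_zpow x hx hx0
  have hk0 : 0 ≤ k := by
    rw [hk, ← zpow_zero (spectralNorm K L ϖ)] at h1
    exact (zpow_le_zpow_iff_right_of_lt_one₀ h.pos h.lt_one).1 h1
  lift k to ℕ using hk0
  exact ⟨k, by rw [hk, zpow_natCast]⟩

theorem le_of_lt_one (h : IsPrimeElt K L T ϖ) {x : L} (hx : x ∈ T) (h1 : spectralNorm K L x < 1) :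
    spectralNorm K L x ≤ spectralNorm K L ϖ := by
  by_cases hx0 : x = 0
  · rw [hx0, spectralNorm_zero]
    exact h.pos.le
  obtain ⟨k, hk⟩ := h.exists_pow hx hx0 h1.le
  have : k ≠ 0 := by
    rintro rfl
    rw [hk, pow_zero] at h1
    exact lt_irrefl _ h1
  rw [hk]
  exact pow_le_of_le_one h.pos.le h.lt_one.le this

theorem of_norm_eq (h : IsPrimeElt K L T ϖ) (hm : ϖ' ∈ T)
    (he : spectralNorm K L ϖ' = spectralNorm K L ϖ) : IsPrimeElt K L T ϖ' where
  mem := hm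
  ne_zero h0 := by
    rw [h0, spectralNorm_zero] at he
    exact h.pos.ne he
  lt_one := he ▸ h.lt_one
  exists_zpow := he ▸ h.exists_zpow

theorem norm_eq (h : IsPrimeElt K L T ϖ) (h' : IsPrimeElt K L T ϖ') :
    spectralNorm K L ϖ' = spectralNorm K L ϖ :=
  le_antisymm (h.le_of_lt_one h'.mem h'.lt_one) (h'.le_of_lt_one h.mem h.lt_one)

/-- A prime element of a larger field lying in a smaller field is a prime element there. -/
theorem of_le (h : IsPrimeElt K L T ϖ) (hle : T' ≤ T) (hm : ϖ ∈ T') : IsPrimeElt K L T' ϖ where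
  mem := hm
  ne_zero := h.ne_zero
  lt_one := h.lt_one
  exists_zpow x hx := h.exists_zpow x (hle hx)

end IsPrimeElt

variable [IsDiscreteValuationRing 𝒪[K]]

theorem exists_uniformizer_base : ∃ ϖ : K, ϖ ≠ 0 ∧ ‖ϖ‖ < 1 ∧
    ∀ x : K, x ≠ 0 → ∃ k : ℤ, ‖x‖ = ‖ϖ‖ ^ k := by
  obtain ⟨ϖ, hϖ⟩ := IsDiscreteValuationRing.exists_irreducible 𝒪[K]
  have hint : ∀ x : K, x ≠ 0 → ‖x‖ ≤ 1 → ∃ k : ℤ, ‖x‖ = ‖(ϖ : K)‖ ^ k := by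
    intro x hx h1
    obtain ⟨n, u, hu⟩ := IsDiscreteValuationRing.eq_unit_mul_pow_irreducible
      (x := (⟨x, Valued.integer.mem_iff.2 h1⟩ : 𝒪[K])) (fun h => hx (congrArg Subtype.val h)) hϖ
    refine ⟨n, ?_⟩
    have h2 := congrArg (fun y : 𝒪[K] => ‖(y : K)‖) hu
    have h3 : ‖((u : 𝒪[K]) : K)‖ = 1 := Valued.integer.norm_coe_unit u
    simpa [h3] using h2
  refine ⟨ϖ, fun h => hϖ.ne_zero (Subtype.ext h), Valued.integer.norm_irreducible_lt_one hϖ, ?_⟩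
  intro x hx
  rcases le_total ‖x‖ 1 with h1 | h1
  · exact hint x hx h1
  · obtain ⟨k, hk⟩ := hint x⁻¹ (inv_ne_zero hx) (by rw [norm_inv]; exact inv_le_one_of_one_le₀ h1)
    exact ⟨-k, by rw [zpow_neg, ← hk, norm_inv, inv_inv]⟩

variable [FiniteDimensional K L] [IsGalois K L]

theorem specNorm_pow_card (x : L) :
    spectralNorm K L x ^ Nat.card (L ≃ₐ[K] L) = ‖Algebra.norm K x‖ := by
  rw [← spectralNorm_extends (K := K) (L := L), Algebra.norm_eq_prod_automorphisms, specNorm_prod,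
    Finset.prod_congr rfl fun σ _ => specNorm_algEquiv K σ x, Finset.prod_const, Finset.card_univ,
    Nat.card_eq_fintype_card]

theorem exists_isPrimeElt (T : IntermediateField K L) : ∃ ϖ, IsPrimeElt K L T ϖ := by
  classical
  obtain ⟨ϖ, h0, h1, hz⟩ := exists_uniformizer_base K
  set n := Nat.card (L ≃ₐ[K] L)
  have hn : n ≠ 0 := Nat.card_pos.ne'
  have hpos : 0 < ‖ϖ‖ := norm_pos_iff.2 h0
  have hk : ∀ x : L, x ≠ 0 → ∃ k : ℤ, spectralNorm K L x ^ n = ‖ϖ‖ ^ k := fun x hx => by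
    rw [specNorm_pow_card]
    exact hz _ (Algebra.norm_ne_zero_iff.2 hx)
  -- The element of `T` whose value is the smallest possible positive one is prime.
  have hex : ∃ k : ℕ, 0 < k ∧ ∃ x ∈ T, x ≠ 0 ∧ spectralNorm K L x ^ n = ‖ϖ‖ ^ k :=
    ⟨n, Nat.pos_of_ne_zero hn, algebraMap K L ϖ, T.algebraMap_mem ϖ, by simpa using h0, by
      rw [spectralNorm_extends]⟩
  obtain ⟨hd, x, hx, hx0, hxd⟩ := Nat.find_spec hex
  set d := Nat.find hex
  have hmin := fun m (hm : m < d) => Nat.find_min hex hm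
  have hx1 : spectralNorm K L x < 1 := by
    by_contra hge
    push Not at hge
    have h2 : ‖ϖ‖ ^ d < 1 := pow_lt_one₀ hpos.le h1 hd.ne'
    rw [← hxd] at h2
    exact absurd h2 (not_lt.2 (one_le_pow₀ hge))
  refine ⟨x, hx, hx0, hx1, fun y hy hy0 => ?_⟩
  obtain ⟨k, hk⟩ := hk y hy0
  have hxp := specNorm_pos K hx0
  -- Division with remainder of the value of `y` by that of `x`.
  set z := y * x ^ (-(k / d)) with hzdef
  have hz0 : z ≠ 0 := mul_ne_zero hy0 (zpow_ne_zero _ hx0)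
  have hzT : z ∈ T := mul_mem hy (zpow_mem hx _)
  have hzn : spectralNorm K L z ^ n = ‖ϖ‖ ^ (k % d) := by
    rw [hzdef, specNorm_mul, mul_pow, hk, specNorm_zpow, ← zpow_natCast (_ ^ (-(k / d))) n,
      zpow_comm, zpow_natCast, hxd, ← zpow_natCast ‖ϖ‖ d, ← zpow_mul, ← zpow_add₀ hpos.ne',
      Int.emod_def]
    congr 1
    ring
  have hr0 : 0 ≤ k % d := Int.emod_nonneg _ (by exact_mod_cast hd.ne')
  have hrd : k % d < d := Int.emod_lt_of_pos _ (by exact_mod_cast hd)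
  obtain ⟨r, hr⟩ := Int.eq_ofNat_of_zero_le hr0
  rw [hr] at hzn hrd
  have hr' : r = 0 := by
    by_contra hne
    exact hmin r (by exact_mod_cast hrd) ⟨Nat.pos_of_ne_zero hne, z, hzT, hz0, by
      rw [hzn, zpow_natCast]⟩
  have hz1 : spectralNorm K L z = 1 := by
    rw [hr', Nat.cast_zero, zpow_zero] at hzn
    exact (pow_eq_one_iff_of_nonneg (specNorm_nonneg K z) hn).1 hzn
  refine ⟨k / d, ?_⟩
  rw [hzdef, specNorm_mul, specNorm_zpow, zpow_neg] at hz1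
  exact eq_of_mul_inv_eq_one hz1

end SpectralNorm

/-! ### Ramification groups in terms of the norm -/

section RamGroup

variable {K : Type*} [NontriviallyNormedField K] [IsUltrametricDist K] [CompleteSpace K]
  {L : Type*} [Field L] [Algebra K L] [Algebra.IsAlgebraic K L]

theorem isUnit_integers_iff (x : integers K L) :
    IsUnit x ↔ spectralNorm K L (x : L) = 1 := by
  constructor
  · rintro ⟨u, rfl⟩
    have h : spectralNorm K L ((u : integers K L) : L)
        * spectralNorm K L ((u⁻¹ : (integers K L)ˣ) : integers K L) = 1 := by
      rw [← specNorm_mul, ← MulMemClass.coe_mul, Units.mul_inv, OneMemClass.coe_one, specNorm_one]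
    have h1 : spectralNorm K L ((u : integers K L) : L) ≤ 1 := (u : integers K L).2
    have h2 : spectralNorm K L ((u⁻¹ : (integers K L)ˣ) : integers K L) ≤ 1 :=
      ((u⁻¹ : (integers K L)ˣ) : integers K L).2
    refine le_antisymm h1 ?_
    rw [← h]
    exact mul_le_of_le_one_right (specNorm_nonneg K _) h2
  · intro h
    have h0 : (x : L) ≠ 0 := fun h0 => by
      rw [h0, spectralNorm_zero] at h
      exact zero_ne_one h
    refine IsUnit.of_mul_eq_one ⟨(x : L)⁻¹, ?_⟩ (Subtype.ext (mul_inv_cancel₀ h0))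
    rw [mem_integers_iff, specNorm_inv, h, inv_one]

theorem mem_maximalIdeal_integers (x : integers K L) :
    x ∈ IsLocalRing.maximalIdeal (integers K L) ↔ spectralNorm K L (x : L) < 1 := by
  rw [IsLocalRing.mem_maximalIdeal, mem_nonunits_iff, isUnit_integers_iff]
  exact ⟨fun h => lt_of_le_of_ne x.2 h, fun h => h.ne⟩

theorem mem_span_singleton_integers (x y : integers K L) :
    x ∈ Ideal.span {y} ↔ spectralNorm K L (x : L) ≤ spectralNorm K L (y : L) := by
  rw [Ideal.mem_span_singleton]
  constructor
  · rintro ⟨z, rfl⟩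
    rw [MulMemClass.coe_mul, specNorm_mul]
    exact mul_le_of_le_one_right (specNorm_nonneg K _) z.2
  · intro h
    by_cases hy : (y : L) = 0
    · rw [hy, spectralNorm_zero] at h
      have hx : (x : L) = 0 := (specNorm_eq_zero K).1 (le_antisymm h (specNorm_nonneg K _))
      exact ⟨0, by rw [mul_zero]; exact Subtype.ext hx⟩
    · refine ⟨⟨x / y, ?_⟩, Subtype.ext (mul_div_cancel₀ _ hy).symm⟩
      rw [mem_integers_iff, specNorm_div]
      exact div_le_one_of_le₀ h (specNorm_nonneg K _)

variable {π : L}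

theorem IsPrimeElt.mem_integers {T : IntermediateField K L} (hπ : IsPrimeElt K L T π) :
    π ∈ integers K L := hπ.lt_one.le

theorem IsPrimeElt.maximalIdeal_eq (hπ : IsPrimeElt K L ⊤ π) :
    IsLocalRing.maximalIdeal (integers K L) = Ideal.span {⟨π, hπ.mem_integers⟩} := by
  ext x
  rw [mem_maximalIdeal_integers, mem_span_singleton_integers]
  exact ⟨fun h => hπ.le_of_lt_one IntermediateField.mem_top h, fun h => h.trans_lt hπ.lt_one⟩

theorem mem_ramGroup_iff (hπ : IsPrimeElt K L ⊤ π) (i : ℕ) (σ : L ≃ₐ[K] L) :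
    σ ∈ ramGroup K L i ↔ ∀ x, spectralNorm K L x ≤ 1 →
      spectralNorm K L (σ x - x) ≤ spectralNorm K L π ^ (i + 1) := by
  have h1 : ∀ x : integers K L,
      (σ • x - x ∈ (IsLocalRing.maximalIdeal (integers K L)) ^ (i + 1)) ↔
      spectralNorm K L (σ x - x) ≤ spectralNorm K L π ^ (i + 1) := by
    intro x
    rw [hπ.maximalIdeal_eq, Ideal.span_singleton_pow, mem_span_singleton_integers]
    simp [coe_smul_integers, specNorm_pow]
  exact ⟨fun h x hx => (h1 ⟨x, hx⟩).1 (h ⟨x, hx⟩), fun h x => (h1 x).2 (h x x.2)⟩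

theorem mem_ramGroup_zero_iff (σ : L ≃ₐ[K] L) :
    σ ∈ ramGroup K L 0 ↔ ∀ x, spectralNorm K L x ≤ 1 → spectralNorm K L (σ x - x) < 1 := by
  have h1 : ∀ x : integers K L,
      (σ • x - x ∈ (IsLocalRing.maximalIdeal (integers K L)) ^ (0 + 1)) ↔
      spectralNorm K L (σ x - x) < 1 := by
    intro x
    rw [zero_add, pow_one, mem_maximalIdeal_integers]
    simp [coe_smul_integers]
  exact ⟨fun h x hx => (h1 ⟨x, hx⟩).1 (h ⟨x, hx⟩), fun h x => (h1 x).2 (h x x.2)⟩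

instance ramGroup_normal (i : ℕ) : (ramGroup K L i).Normal := by
  constructor
  intro σ hσ τ x
  have h := hσ (τ⁻¹ • x)
  have hI : ∀ y ∈ (IsLocalRing.maximalIdeal (integers K L)) ^ (i + 1),
      τ • y ∈ (IsLocalRing.maximalIdeal (integers K L)) ^ (i + 1) := by
    intro y hy
    have hle : (IsLocalRing.maximalIdeal (integers K L)).map
        (MulSemiringAction.toRingHom (L ≃ₐ[K] L) (integers K L) τ)
          ≤ IsLocalRing.maximalIdeal (integers K L) := by
      rw [Ideal.map_le_iff_le_comap]
      intro z hz
      rw [Ideal.mem_comap, MulSemiringAction.toRingHom_apply, mem_maximalIdeal_integers,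
        coe_smul_integers, specNorm_algEquiv]
      exact (mem_maximalIdeal_integers z).1 hz
    have h2 := Ideal.mem_map_of_mem
      (MulSemiringAction.toRingHom (L ≃ₐ[K] L) (integers K L) τ) hy
    rw [Ideal.map_pow] at h2
    exact Ideal.pow_right_mono hle _ h2
  have := hI _ h
  rw [smul_sub, smul_inv_smul, ← mul_smul, ← mul_smul] at this
  exact this

end RamGroup

/-! ### Residue fields and subgroups of the inertia group -/

section Residue

variable (K : Type*) [NontriviallyNormedField K] [IsUltrametricDist K] [CompleteSpace K]
  (L : Type*) [Field L] [Algebra K L] [Algebra.IsAlgebraic K L]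

/-- The inclusion of the valuation ring of `K` into that of `L`. -/
def baseIntegers : 𝒪[K] →+* integers K L where
  toFun x := ⟨algebraMap K L x, by
    rw [mem_integers_iff, spectralNorm_extends]
    exact Valued.integer.mem_iff.1 x.2⟩
  map_one' := Subtype.ext (by simp)
  map_mul' x y := Subtype.ext (by simp)
  map_zero' := Subtype.ext (by simp)
  map_add' x y := Subtype.ext (by simp)

theorem coe_baseIntegers (x : 𝒪[K]) : (baseIntegers K L x : L) = algebraMap K L x := rfl

instance : IsLocalHom (baseIntegers K L) where
  map_nonunit x hx := by
    rw [isUnit_integers_iff, coe_baseIntegers, spectralNorm_extends] at hx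
    exact Valued.integer.isUnit_iff_norm_eq_one.2 hx

instance : Algebra 𝓀[K] (IsLocalRing.ResidueField (integers K L)) :=
  (IsLocalRing.ResidueField.map (baseIntegers K L)).toAlgebra

instance : Algebra.IsAlgebraic 𝓀[K] (IsLocalRing.ResidueField (integers K L)) := by
  refine ⟨fun y => IsIntegral.isAlgebraic ?_⟩
  obtain ⟨y, rfl⟩ := IsLocalRing.residue_surjective y
  have hint : IsIntegral K (y : L) := Algebra.IsIntegral.isIntegral _
  have hm := minpoly.monic hint
  have hc : (↑(minpoly K (y : L)).coeffs : Set K) ⊆ (𝒪[K] : Subring K) := by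
    intro c hc
    obtain ⟨n, -, rfl⟩ := Polynomial.mem_coeffs_iff.1 hc
    exact Valued.integer.mem_iff.2 ((spectralValue_le_one_iff hm).1 y.2 n)
  set P := (minpoly K (y : L)).toSubring (𝒪[K] : Subring K) hc with hP
  have hPm : P.Monic := (Polynomial.monic_toSubring _ _ hc).2 hm
  have hP0 : P.eval₂ (baseIntegers K L) y = 0 := by
    apply Subtype.ext
    have h1 := Polynomial.hom_eval₂ P (baseIntegers K L) (integers K L).subtype y
    have h2 : (integers K L).subtype.comp (baseIntegers K L)
        = (algebraMap K L).comp (𝒪[K] : Subring K).subtype := rfl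
    have h4 : P.map (𝒪[K] : Subring K).subtype = minpoly K (y : L) :=
      Polynomial.map_toSubring _ _ hc
    rw [h2, ← Polynomial.eval₂_map, h4] at h1
    exact h1.trans (minpoly.aeval K (y : L))
  refine ⟨P.map (IsLocalRing.residue 𝒪[K]), hPm.map _, ?_⟩
  have h3 := congrArg (IsLocalRing.residue (integers K L)) hP0
  rw [Polynomial.hom_eval₂, map_zero] at h3
  rw [Polynomial.eval₂_map]
  exact h3

variable {K L}

theorem residue_eq_iff (x y : integers K L) :
    IsLocalRing.residue (integers K L) x = IsLocalRing.residue (integers K L) y ↔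
      spectralNorm K L ((x : L) - y) < 1 := by
  rw [← sub_eq_zero, ← map_sub, IsLocalRing.residue_eq_zero_iff, mem_maximalIdeal_integers]
  rfl

theorem exists_mul_expChar_pow (k : Type*) [Field k] (p : ℕ) [ExpChar k p] {N : ℕ} (hN : N ≠ 0) :
    ∃ a m : ℕ, N = p ^ a * m ∧ (m : k) ≠ 0 := by
  obtain _ | hp := ‹ExpChar k p›
  · exact ⟨0, N, by simp, by exact_mod_cast hN⟩
  · obtain ⟨a, m, hm, h⟩ := Nat.exists_eq_pow_mul_and_not_dvd hN p hp.ne_one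
    exact ⟨a, m, h, fun h0 => hm ((CharP.cast_eq_zero_iff k p m).1 h0)⟩

variable [PerfectField 𝓀[K]] [FiniteDimensional K L]

/-- If `H` acts trivially on the residue field of `L`, then `L^H` has the same residue field as
`L`. The characteristic polynomial of `x` over `L^H` reduces to `(X - x̄)^|H|`, so that a power
`x̄^(p^a)` lies in the residue field of `L^H`; as `x̄` is separable over the residue field `κ` of
`K`, it lies in `κ(x̄^(p^a))`. -/
theorem exists_fixed_sub_lt_one {H : Subgroup (L ≃ₐ[K] L)} (hH : H ≤ ramGroup K L 0) {x : L}
    (hx : spectralNorm K L x ≤ 1) :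
    ∃ c ∈ IntermediateField.fixedField H,
      spectralNorm K L c ≤ 1 ∧ spectralNorm K L (x - c) < 1 := by
  classical
  have := Fintype.ofFinite H
  set res := IsLocalRing.residue (integers K L)
  set xi : integers K L := ⟨x, hx⟩
  obtain ⟨p, hp⟩ := ExpChar.exists 𝓀[K]
  have hpL : ExpChar (IsLocalRing.ResidueField (integers K L)) p :=
    expChar_of_injective_algebraMap
      (algebraMap 𝓀[K] (IsLocalRing.ResidueField (integers K L))).injective p
  obtain ⟨a, m, hN, hm⟩ := exists_mul_expChar_pow (IsLocalRing.ResidueField (integers K L)) p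
    (Nat.card_pos (α := H)).ne'
  have hm0 : m ≠ 0 := fun h => hm (by simp [h])
  have hp0 : p ≠ 0 := (expChar_pos 𝓀[K] p).ne'
  set P := MulSemiringAction.charpoly H xi with hP
  have hPmap : P.map res
      = Polynomial.expand _ (p ^ a) ((Polynomial.X - Polynomial.C (res xi ^ p ^ a)) ^ m) := by
    have h1 : P.map res = (Polynomial.X - Polynomial.C (res xi)) ^ Nat.card H := by
      rw [hP, MulSemiringAction.charpoly_eq, Polynomial.map_prod, Nat.card_eq_fintype_card,
        ← Finset.card_univ, ← Finset.prod_const]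
      refine Finset.prod_congr rfl fun h _ => ?_
      have : res (h • xi) = res xi := by
        refine (residue_eq_iff _ _).2 ?_
        exact (mem_ramGroup_zero_iff _).1 (hH h.2) x hx
      simp [this]
    rw [h1, hN, pow_mul, sub_pow_expChar_pow]
    simp [Polynomial.expand_X]
  set b := P.coeff (m.pred * p ^ a) with hb
  have hbres : res b = -(res xi ^ p ^ a) * m := by
    rw [hb, ← Polynomial.coeff_map, hPmap,
      Polynomial.coeff_expand_mul (pow_pos (Nat.pos_of_ne_zero hp0) a),
      sub_eq_add_neg, ← Polynomial.C_neg, Polynomial.coeff_X_add_C_pow]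
    have h1 : m - m.pred = 1 := by rw [Nat.pred_eq_sub_one]; omega
    have h2 : m.choose m.pred = m := by
      have : ∀ n : ℕ, n ≠ 0 → n.choose n.pred = n := by
        rintro (_ | n) hn
        · exact absurd rfl hn
        · exact Nat.choose_succ_self_right n
      exact this m hm0
    rw [h1, h2, pow_one]
  have hbH : ∀ σ ∈ H, σ • b = b := fun σ hσ =>
    MulSemiringAction.smul_coeff_charpoly xi (m.pred * p ^ a) (⟨σ, hσ⟩ : H)
  -- `x̄` is a polynomial in `b̄` over the residue field of `K`.
  have hsep : IsSeparable 𝓀[K] (res xi) := Algebra.IsSeparable.isSeparable 𝓀[K] (res xi)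
  have hmem : res xi ∈ IntermediateField.adjoin 𝓀[K] {res b} := by
    have h1 : res xi ∈ IntermediateField.adjoin 𝓀[K] {res xi} :=
      IntermediateField.mem_adjoin_simple_self _ _
    rw [IntermediateField.adjoin_simple_eq_adjoin_pow_expChar_pow_of_isSeparable _ _ hsep p a]
      at h1
    refine (IntermediateField.adjoin_simple_le_iff.2 ?_) h1
    have h2 : res xi ^ p ^ a = -(res b * (m : IsLocalRing.ResidueField (integers K L))⁻¹) := by
      rw [hbres]
      field_simp
    rw [h2]
    exact neg_mem (mul_mem (IntermediateField.mem_adjoin_simple_self _ _)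
      (inv_mem (natCast_mem _ m)))
  rw [← IntermediateField.mem_toSubalgebra,
    IntermediateField.adjoin_simple_toSubalgebra_of_isAlgebraic
      (Algebra.IsAlgebraic.isAlgebraic _),
    Algebra.adjoin_singleton_eq_range_aeval] at hmem
  obtain ⟨g, hg⟩ := hmem
  obtain ⟨g, rfl⟩ := Polynomial.map_surjective (IsLocalRing.residue 𝒪[K])
    IsLocalRing.residue_surjective g
  set c := g.eval₂ (baseIntegers K L) b with hc
  refine ⟨c, ?_, c.2, ?_⟩
  · rw [IntermediateField.mem_fixedField_iff]
    intro σ hσ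
    have h1 := Polynomial.hom_eval₂ g (baseIntegers K L)
      (MulSemiringAction.toRingHom (L ≃ₐ[K] L) (integers K L) σ) b
    have h2 : (MulSemiringAction.toRingHom (L ≃ₐ[K] L) (integers K L) σ).comp (baseIntegers K L)
        = baseIntegers K L := by
      ext y
      exact σ.commutes y
    rw [h2, MulSemiringAction.toRingHom_apply, MulSemiringAction.toRingHom_apply, hbH σ hσ] at h1
    exact congrArg Subtype.val h1
  · refine (residue_eq_iff xi c).1 ?_
    have h1 := Polynomial.hom_eval₂ g (baseIntegers K L) res b
    rw [hc, h1]
    refine Eq.trans ?_ (Polynomial.eval₂_map (IsLocalRing.residue 𝒪[K]) (algebraMap 𝓀[K]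
      (IsLocalRing.ResidueField (integers K L))) (res b))
    exact hg.symm

end Residue

/-! ### Ramification indices and the ramification filtration of a subextension -/

section Inertia

variable {K : Type*} [NontriviallyNormedField K] [IsUltrametricDist K] [CompleteSpace K]
  {L : Type*} [Field L] [Algebra K L] [Algebra.IsAlgebraic K L]
  [PerfectField 𝓀[K]] [FiniteDimensional K L]

/-- If `T` contains the inertia field, elements of the inertia group move integral elements of `T`
at most as much as a prime element of `T`. -/
theorem specNorm_apply_sub_le {σ : L ≃ₐ[K] L} (hσ : σ ∈ ramGroup K L 0)
    {T : IntermediateField K L} (hT : IntermediateField.fixedField (ramGroup K L 0) ≤ T) {ϖ : L}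
    (hϖ : IsPrimeElt K L T ϖ) {a : L} (ha : a ∈ T) (ha1 : spectralNorm K L a ≤ 1) :
    spectralNorm K L (σ a - a) ≤ spectralNorm K L (σ ϖ - ϖ) := by
  have key : ∀ N : ℕ, ∀ a ∈ T, spectralNorm K L a ≤ 1 → spectralNorm K L (σ a - a)
      ≤ max (spectralNorm K L (σ ϖ - ϖ)) (spectralNorm K L ϖ ^ N) := by
    intro N
    induction N with
    | zero =>
      intro a _ ha1
      rw [pow_zero]
      refine le_max_of_le_right ((specNorm_sub_le K _ _).trans (max_le ?_ ha1))
      rwa [specNorm_algEquiv]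
    | succ N ih =>
      intro a ha ha1
      -- Write `a = c + ϖ b` with `c` in the inertia field.
      obtain ⟨c, hc, hc1, hac⟩ := exists_fixed_sub_lt_one le_rfl ha1
      have hσc : σ c = c := (IntermediateField.mem_fixedField_iff _ _).1 hc σ hσ
      have hacT : a - c ∈ T := sub_mem ha (hT hc)
      set b := (a - c) / ϖ with hb
      have hab : a = c + ϖ * b := by rw [hb, mul_div_cancel₀ _ hϖ.ne_zero]; ring
      have hbT : b ∈ T := div_mem hacT hϖ.mem
      have hb1 : spectralNorm K L b ≤ 1 := by
        rw [hb, specNorm_div]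
        exact div_le_one_of_le₀ (hϖ.le_of_lt_one hacT hac) hϖ.pos.le
      have hid : σ a - a = (σ ϖ - ϖ) * σ b + ϖ * (σ b - b) := by
        rw [hab, map_add, map_mul, hσc]
        ring
      rw [hid]
      refine (specNorm_add_le K _ _).trans (max_le ?_ ?_)
      · rw [specNorm_mul, specNorm_algEquiv]
        exact le_max_of_le_left (mul_le_of_le_one_right (specNorm_nonneg K _) hb1)
      · rw [specNorm_mul]
        refine (mul_le_mul_of_nonneg_left (ih b hbT hb1) hϖ.pos.le).trans ?_
        rw [mul_max_of_nonneg _ _ hϖ.pos.le, pow_succ']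
        exact max_le_max (mul_le_of_le_one_left (specNorm_nonneg K _) hϖ.lt_one.le) le_rfl
  by_contra hlt
  push Not at hlt
  obtain ⟨N, hN⟩ := exists_pow_lt_of_lt_one ((specNorm_nonneg K _).trans_lt hlt) hϖ.lt_one
  exact absurd (key N a ha ha1) (not_le.2 (max_lt hlt hN))

theorem mem_ramGroup_iff_prime {π : L} (hπ : IsPrimeElt K L ⊤ π) {σ : L ≃ₐ[K] L}
    (hσ : σ ∈ ramGroup K L 0) (i : ℕ) :
    σ ∈ ramGroup K L i ↔ spectralNorm K L (σ π - π) ≤ spectralNorm K L π ^ (i + 1) := by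
  rw [mem_ramGroup_iff hπ]
  exact ⟨fun h => h π hπ.lt_one.le, fun h x hx =>
    (specNorm_apply_sub_le hσ le_top hπ IntermediateField.mem_top hx).trans h⟩

theorem eq_one_of_apply_prime {π : L} (hπ : IsPrimeElt K L ⊤ π) {σ : L ≃ₐ[K] L}
    (hσ : σ ∈ ramGroup K L 0) (h : σ π = π) : σ = 1 := by
  have hint : ∀ x : L, spectralNorm K L x ≤ 1 → σ x = x := by
    intro x hx
    have := specNorm_apply_sub_le hσ le_top hπ IntermediateField.mem_top hx
    rw [h, sub_self, spectralNorm_zero] at this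
    exact sub_eq_zero.1 ((specNorm_eq_zero K).1 (le_antisymm this (specNorm_nonneg K _)))
  ext x
  rcases le_total (spectralNorm K L x) 1 with h1 | h1
  · exact hint x h1
  · have h2 := hint x⁻¹ (by rw [specNorm_inv]; exact inv_le_one_of_one_le₀ h1)
    rw [map_inv₀] at h2
    exact inv_injective h2

/-- A group `H` of automorphisms acting trivially on the residue field is totally ramified: the
ramification index of `L/L^H` is `|H|`. If the index were smaller, there would be a nonzero
combination `D` of the elements of `H` killing all `π^i` with `i` less than the index; being
`L^H`-linear and bounded, `D` would vanish, against the independence of characters. -/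
theorem specNorm_prime_of_le_inertia {H : Subgroup (L ≃ₐ[K] L)} (hH : H ≤ ramGroup K L 0)
    {π ϖ : L} (hπ : IsPrimeElt K L ⊤ π)
    (hϖ : IsPrimeElt K L (IntermediateField.fixedField H) ϖ) :
    spectralNorm K L ϖ = spectralNorm K L π ^ Nat.card H := by
  classical
  have := Fintype.ofFinite H
  have hπinj : Function.Injective fun n : ℕ => spectralNorm K L π ^ n :=
    fun a b hab => le_antisymm
      ((pow_le_pow_iff_right_of_lt_one₀ hπ.pos hπ.lt_one).1 hab.ge)
      ((pow_le_pow_iff_right_of_lt_one₀ hπ.pos hπ.lt_one).1 hab.le)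
  obtain ⟨e, he⟩ := hπ.exists_pow IntermediateField.mem_top hϖ.ne_zero hϖ.lt_one.le
  have he0 : e ≠ 0 := by
    rintro rfl
    exact hϖ.lt_one.ne (by rw [he, pow_zero])
  -- `e` divides `|H|`, as the norm of `π` to `L^H` has value `|H|`.
  set n := ∏ h : H, (h : L ≃ₐ[K] L) π with hn
  have hnH : n ∈ IntermediateField.fixedField H := by
    rw [IntermediateField.mem_fixedField_iff]
    intro σ hσ
    rw [hn, map_prod]
    exact Fintype.prod_equiv (Equiv.mulLeft (⟨σ, hσ⟩ : H)) _ _ fun h => rfl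
  have hnn : spectralNorm K L n = spectralNorm K L π ^ Nat.card H := by
    rw [hn, specNorm_prod, Finset.prod_congr rfl fun h _ => specNorm_algEquiv K _ π,
      Finset.prod_const, Finset.card_univ, Nat.card_eq_fintype_card]
  have hn0 : n ≠ 0 := Finset.prod_ne_zero_iff.2 fun h _ => by simpa using hπ.ne_zero
  obtain ⟨k, hk⟩ := hϖ.exists_pow hnH hn0 (by rw [hnn]; exact pow_le_one₀ hπ.pos.le hπ.lt_one.le)
  have hek : Nat.card H = e * k := by
    rw [hnn, he, ← pow_mul] at hk
    exact hπinj hk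
  have hk0 : k ≠ 0 := by
    rintro rfl
    exact Nat.card_pos.ne' hek
  rw [he]
  congr 1
  refine le_antisymm (by rw [hek]; exact Nat.le_mul_of_pos_right _ (Nat.pos_of_ne_zero hk0)) ?_
  by_contra hlt
  push Not at hlt
  let M : Matrix (Fin e) H L := fun i h => (h : L ≃ₐ[K] L) π ^ (i : ℕ)
  have hker : LinearMap.ker M.mulVecLin ≠ ⊥ := LinearMap.ker_ne_bot_of_finrank_lt (by
    simpa [Nat.card_eq_fintype_card] using hlt)
  obtain ⟨c, hc, hc0⟩ := Submodule.exists_mem_ne_zero_of_ne_bot hker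
  have hcM : ∀ i < e, ∑ h : H, c h * (h : L ≃ₐ[K] L) (π ^ i) = 0 := by
    intro i hi
    have := congrFun (LinearMap.mem_ker.1 hc) ⟨i, hi⟩
    rw [Matrix.mulVecLin_apply] at this
    simpa [M, Matrix.mulVec, dotProduct, mul_comm] using this
  set D : L → L := fun x => ∑ h : H, c h * (h : L ≃ₐ[K] L) x with hD
  have hDadd : ∀ x y, D (x + y) = D x + D y := fun x y => by
    simp [hD, mul_add, Finset.sum_add_distrib]
  have hDmul : ∀ t ∈ IntermediateField.fixedField H, ∀ x, D (t * x) = t * D x := by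
    intro t ht x
    simp only [hD, Finset.mul_sum]
    refine Finset.sum_congr rfl fun h _ => ?_
    rw [map_mul, (IntermediateField.mem_fixedField_iff _ _).1 ht h h.2]
    ring
  -- Expand an integral `x` in powers of `π`, with coefficients in `L^H`.
  have hstep : ∀ k ≤ e, ∀ x, spectralNorm K L x ≤ 1 →
      ∃ y, spectralNorm K L y ≤ 1 ∧ D x = D (π ^ k * y) := by
    intro k
    induction k with
    | zero => exact fun _ x hx => ⟨x, hx, by simp⟩
    | succ k ih =>
      intro hk x hx
      obtain ⟨y, hy, hxy⟩ := ih (Nat.le_of_succ_le hk) x hx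
      obtain ⟨t, ht, -, hyt⟩ := exists_fixed_sub_lt_one hH hy
      refine ⟨(y - t) / π, ?_, ?_⟩
      · rw [specNorm_div]
        exact div_le_one_of_le₀ (hπ.le_of_lt_one IntermediateField.mem_top hyt) hπ.pos.le
      · have h1 : π ^ k * y = t * π ^ k + π ^ (k + 1) * ((y - t) / π) := by
          have := hπ.ne_zero
          field_simp
          ring
        have h2 : D (π ^ k) = 0 := hcM k (Nat.lt_of_succ_le hk)
        rw [hxy, h1, hDadd, hDmul t ht, h2, mul_zero, zero_add]
  have hstep' : ∀ x, spectralNorm K L x ≤ 1 →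
      ∃ y, spectralNorm K L y ≤ 1 ∧ D x = ϖ * D y := by
    intro x hx
    obtain ⟨y, hy, hxy⟩ := hstep e le_rfl x hx
    refine ⟨π ^ e / ϖ * y, ?_, ?_⟩
    · rw [specNorm_mul, specNorm_div, specNorm_pow, he, div_self (pow_pos hπ.pos e).ne', one_mul]
      exact hy
    · rw [hxy, ← hDmul ϖ hϖ.mem]
      congr 1
      have := hϖ.ne_zero
      field_simp
  obtain ⟨C, hC0, hC⟩ : ∃ C : ℝ, 0 ≤ C ∧
      ∀ x, spectralNorm K L x ≤ 1 → spectralNorm K L (D x) ≤ C := by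
    refine ⟨∑ h : H, spectralNorm K L (c h), Finset.sum_nonneg fun h _ => specNorm_nonneg K _,
      fun x hx => specNorm_sum_le K _ _ (Finset.sum_nonneg fun h _ => specNorm_nonneg K _) ?_⟩
    intro h _
    rw [specNorm_mul, specNorm_algEquiv]
    exact (mul_le_of_le_one_right (specNorm_nonneg K _) hx).trans
      (Finset.single_le_sum (f := fun h => spectralNorm K L (c h))
        (fun h _ => specNorm_nonneg K _) (Finset.mem_univ h))
  have hbound : ∀ N : ℕ, ∀ x, spectralNorm K L x ≤ 1 →
      spectralNorm K L (D x) ≤ spectralNorm K L ϖ ^ N * C := by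
    intro N
    induction N with
    | zero => simpa using hC
    | succ N ih =>
      intro x hx
      obtain ⟨y, hy, hxy⟩ := hstep' x hx
      rw [hxy, specNorm_mul, pow_succ', mul_assoc]
      exact mul_le_mul_of_nonneg_left (ih y hy) hϖ.pos.le
  have hDint : ∀ x, spectralNorm K L x ≤ 1 → D x = 0 := by
    intro x hx
    by_contra hne
    have hpos := specNorm_pos K hne
    have hCpos : 0 < C := hpos.trans_le (hC x hx)
    obtain ⟨N, hN⟩ := exists_pow_lt_of_lt_one (div_pos hpos hCpos) hϖ.lt_one
    exact absurd (hbound N x hx) (not_le.2 ((lt_div_iff₀ hCpos).1 hN))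
  have hD0 : ∀ x, D x = 0 := by
    intro x
    by_cases hx0 : x = 0
    · exact hDint x (by rw [hx0, spectralNorm_zero]; exact zero_le_one)
    obtain ⟨N, hN⟩ := exists_pow_lt_of_lt_one (inv_pos.2 (specNorm_pos K hx0)) hϖ.lt_one
    have h1 := hDint (ϖ ^ N * x) (by
      rw [specNorm_mul, specNorm_pow]
      exact ((lt_inv_mul_iff₀' (specNorm_pos K hx0)).1 (by simpa using hN)).le)
    rw [hDmul _ (pow_mem hϖ.mem N)] at h1
    exact (mul_eq_zero.1 h1).resolve_left (pow_ne_zero _ hϖ.ne_zero)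
  have hli := (linearIndependent_monoidHom L L).comp
    (fun h : H => ((h : L ≃ₐ[K] L) : L →* L)) (fun h h' hh => Subtype.ext (AlgEquiv.ext fun x =>
      DFunLike.congr_fun hh x))
  refine hc0 (funext (Fintype.linearIndependent_iff.1 hli c (funext fun x => ?_)))
  have := hD0 x
  simpa [hD, Finset.sum_apply] using this

/-- The extension of `L^H` cut out by the inertia subgroup `H₀` of `H` is unramified: every value of
`L^{H₀}` is a value of `L^H`. For a prime element `ϖ` of `L^{H₀}` and a suitable integral `x` the
trace of `x ϖ` has the norm of `ϖ`, by independence of the automorphisms of the residue field that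
come from `H/H₀`. -/
theorem exists_mem_fixedField_specNorm_eq (H : Subgroup (L ≃ₐ[K] L)) {ϖ : L}
    (hϖ : IsPrimeElt K L (IntermediateField.fixedField (H ⊓ ramGroup K L 0)) ϖ) :
    ∃ y ∈ IntermediateField.fixedField H, spectralNorm K L y = spectralNorm K L ϖ := by
  classical
  set N := (ramGroup K L 0).subgroupOf H with hN
  have := Fintype.ofFinite (H ⧸ N)
  set res := IsLocalRing.residue (integers K L)
  let act : H ⧸ N → IsLocalRing.ResidueField (integers K L) →*
      IsLocalRing.ResidueField (integers K L) := fun q =>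
    (MulSemiringAction.toRingHom (L ≃ₐ[K] L) (IsLocalRing.ResidueField (integers K L))
      (q.out : L ≃ₐ[K] L) : _ →+* _)
  have hact : ∀ q (x : integers K L), act q (res x) = res ((q.out : L ≃ₐ[K] L) • x) :=
    fun q x => rfl
  have hinj : Function.Injective act := by
    intro q q' hqq
    rw [← QuotientGroup.out_eq' q, ← QuotientGroup.out_eq' q', QuotientGroup.eq]
    refine Subgroup.mem_subgroupOf.2 ((mem_ramGroup_zero_iff _).2 fun x hx => ?_)
    have h1 : act q (res ⟨x, hx⟩) = act q' (res ⟨x, hx⟩) := by rw [hqq]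
    rw [hact, hact, residue_eq_iff, coe_smul_integers, coe_smul_integers,
      ← specNorm_algEquiv K (q.out : L ≃ₐ[K] L)⁻¹, map_sub, specNorm_sub_comm] at h1
    simpa [AlgEquiv.mul_apply] using h1
  have hϖ1 : ∀ σ : L ≃ₐ[K] L, spectralNorm K L (σ ϖ / ϖ) = 1 := fun σ => by
    rw [specNorm_div, specNorm_algEquiv, div_self hϖ.pos.ne']
  let c : H ⧸ N → integers K L := fun q => ⟨(q.out : L ≃ₐ[K] L) ϖ / ϖ, (hϖ1 _).le⟩
  have hc : ∀ q, res (c q) ≠ 0 := fun q h0 => by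
    rw [IsLocalRing.residue_eq_zero_iff, mem_maximalIdeal_integers] at h0
    exact h0.ne (hϖ1 _)
  obtain ⟨x, hx⟩ : ∃ x, ∑ q, res (c q) * act q x ≠ 0 := by
    by_contra hcon
    push Not at hcon
    have hli := (linearIndependent_monoidHom (IsLocalRing.ResidueField (integers K L))
      (IsLocalRing.ResidueField (integers K L))).comp act hinj
    refine hc (1 : H ⧸ N) (Fintype.linearIndependent_iff.1 hli (fun q => res (c q))
      (funext fun x => ?_) 1)
    simpa [Finset.sum_apply] using hcon x
  obtain ⟨x, rfl⟩ := IsLocalRing.residue_surjective x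
  obtain ⟨t, ht, ht1, hxt⟩ := exists_fixed_sub_lt_one
    (H := H ⊓ ramGroup K L 0) inf_le_right (x := (x : L)) x.2
  set ti : integers K L := ⟨t, ht1⟩
  have hres : res x = res ti := (residue_eq_iff x ti).2 hxt
  rw [show IsLocalRing.residue (integers K L) x = res ti from hres] at hx
  set z := t * ϖ with hz
  have hzfix : ∀ h : H, h ∈ N → (h : L ≃ₐ[K] L) z = z := fun h hh =>
    (IntermediateField.mem_fixedField_iff _ _).1 (mul_mem ht hϖ.mem) h
      ⟨h.2, Subgroup.mem_subgroupOf.1 hh⟩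
  -- The trace from `L^{H₀}` to `L^H`, as a sum over the cosets of `H₀` in `H`.
  let F : H ⧸ N → L := Quotient.lift (fun h : H => (h : L ≃ₐ[K] L) z) (by
    intro a b hab
    have h1 := hzfix (a⁻¹ * b) (QuotientGroup.leftRel_apply.1 hab)
    have h2 := congrArg (a : L ≃ₐ[K] L) h1
    have h3 : b = a * (a⁻¹ * b) := by group
    change (a : L ≃ₐ[K] L) z = (b : L ≃ₐ[K] L) z
    rw [← h2]
    conv_rhs => rw [h3]
    rfl)
  have hFmk : ∀ h : H, F (h : H ⧸ N) = (h : L ≃ₐ[K] L) z := fun h => rfl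
  have hFout : ∀ q, F q = (q.out : L ≃ₐ[K] L) z := fun q => by
    conv_lhs => rw [← QuotientGroup.out_eq' q]
    rw [hFmk]
  refine ⟨∑ q, F q, ?_, ?_⟩
  · rw [IntermediateField.mem_fixedField_iff]
    intro σ hσ
    rw [map_sum]
    refine Fintype.sum_equiv (MulAction.toPerm (⟨σ, hσ⟩ : H)) _ _ fun q => ?_
    induction q using QuotientGroup.induction_on with
    | H h => rfl
  · have hsum : ∑ q, F q = ϖ * ((∑ q, c q * ((q.out : L ≃ₐ[K] L) • ti) : integers K L) : L) := by
      rw [AddSubmonoidClass.coe_finsetSum, Finset.mul_sum]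
      refine Finset.sum_congr rfl fun q _ => ?_
      rw [hFout, hz, map_mul, MulMemClass.coe_mul, coe_smul_integers]
      have := hϖ.ne_zero
      simp only [c, ti]
      field_simp
    have hunit : spectralNorm K L ((∑ q, c q * ((q.out : L ≃ₐ[K] L) • ti) : integers K L) : L)
        = 1 := by
      rw [← isUnit_integers_iff]
      by_contra hnu
      refine hx ?_
      have h1 := (IsLocalRing.residue_eq_zero_iff _).2
        ((IsLocalRing.mem_maximalIdeal _).2 hnu)
      rw [map_sum] at h1
      rw [← h1]
      exact Finset.sum_congr rfl fun q _ => by rw [map_mul, hact]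
    rw [hsum, specNorm_mul, hunit, mul_one]

variable [IsGalois K L] [IsDiscreteValuationRing 𝒪[K]]

/-- The ramification index of `L/L^H` is the order of the inertia subgroup of `H`. -/
theorem specNorm_prime_fixedField {H : Subgroup (L ≃ₐ[K] L)} {π ϖ : L}
    (hπ : IsPrimeElt K L ⊤ π) (hϖ : IsPrimeElt K L (IntermediateField.fixedField H) ϖ) :
    spectralNorm K L ϖ = spectralNorm K L π ^ Nat.card ↥(H ⊓ ramGroup K L 0) := by
  obtain ⟨ϖ₀, h0⟩ := exists_isPrimeElt K
    (IntermediateField.fixedField (H ⊓ ramGroup K L 0) : IntermediateField K L)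
  obtain ⟨y, hy, hyn⟩ := exists_mem_fixedField_specNorm_eq H h0
  have hle : (IntermediateField.fixedField H : IntermediateField K L)
      ≤ IntermediateField.fixedField (H ⊓ ramGroup K L 0) :=
    IntermediateField.fixedField_antitone inf_le_left
  have hyp := (h0.of_norm_eq (hle hy) hyn).of_le hle hy
  rw [hyp.norm_eq hϖ, hyn]
  exact specNorm_prime_of_le_inertia inf_le_right hπ h0

/-- For `σ` in the inertia group, the distance of `σ` from the identity on `L^H` is the product of
the distances from the identity of the elements of the coset of `σ` modulo the inertia subgroup
`H₀` of `H`. The product is `f^σ(π)` for the characteristic polynomial `f` of `π` over `L^{H₀}`; in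
`f^σ(π) = f^σ(π) - f(π)` the contribution of the constant term, which is a prime element, is the
largest one. -/
theorem prod_specNorm_apply_sub {H : Subgroup (L ≃ₐ[K] L)} {π ϖ : L}
    (hπ : IsPrimeElt K L ⊤ π) (hϖ : IsPrimeElt K L (IntermediateField.fixedField H) ϖ)
    {σ : L ≃ₐ[K] L} (hσ : σ ∈ ramGroup K L 0) (hσϖ : σ ϖ ≠ ϖ) :
    ∏ᶠ h : ↥(H ⊓ ramGroup K L 0), spectralNorm K L (σ ((h : L ≃ₐ[K] L) π) - π)
      = spectralNorm K L (σ ϖ - ϖ) := by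
  classical
  set H₀ := H ⊓ ramGroup K L 0 with hH₀
  have := Fintype.ofFinite H₀
  set T : IntermediateField K L := IntermediateField.fixedField H₀ with hTdef
  have hT : IntermediateField.fixedField (ramGroup K L 0) ≤ T :=
    IntermediateField.fixedField_antitone inf_le_right
  have hle : (IntermediateField.fixedField H : IntermediateField K L) ≤ T :=
    IntermediateField.fixedField_antitone inf_le_left
  have hnorm := specNorm_prime_fixedField hπ hϖ
  obtain ⟨ϖ₀, h0⟩ := exists_isPrimeElt K T
  have hϖT : IsPrimeElt K L T ϖ := h0.of_norm_eq (hle hϖ.mem) (by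
    rw [hnorm, specNorm_prime_of_le_inertia inf_le_right hπ h0])
  set δ := spectralNorm K L (σ ϖ - ϖ) with hδ
  have hδ0 : 0 < δ := specNorm_pos K (sub_ne_zero.2 hσϖ)
  set πi : integers K L := ⟨π, hπ.mem_integers⟩
  set P := MulSemiringAction.charpoly H₀ πi with hP
  set s := MulSemiringAction.toRingHom (L ≃ₐ[K] L) (integers K L) σ
  have hcoeffT : ∀ i, (P.coeff i : L) ∈ T := by
    intro i
    rw [hTdef, IntermediateField.mem_fixedField_iff]
    intro τ hτ
    exact congrArg Subtype.val (MulSemiringAction.smul_coeff_charpoly πi i (⟨τ, hτ⟩ : H₀))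
  have hle' : ∀ i, spectralNorm K L (σ (P.coeff i) - P.coeff i) ≤ δ := fun i =>
    specNorm_apply_sub_le hσ hT hϖT (hcoeffT i) (P.coeff i).2
  have h0eval : ((P.coeff 0 : integers K L) : L) = ∏ h : H₀, -((h : L ≃ₐ[K] L) π) := by
    have h1 : P.coeff 0 = ∏ h : H₀, -(h • πi) := by
      rw [Polynomial.coeff_zero_eq_eval_zero, hP, MulSemiringAction.charpoly_eq,
        Polynomial.eval_prod]
      simp
    rw [h1, SubmonoidClass.coe_finsetProd]
    rfl
  have h0norm : spectralNorm K L (P.coeff 0 : L) = spectralNorm K L ϖ := by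
    rw [h0eval, specNorm_prod, hnorm]
    simp_rw [specNorm_neg, specNorm_algEquiv]
    rw [Finset.prod_const, Finset.card_univ, ← Nat.card_eq_fintype_card]
  have h0prime : IsPrimeElt K L T (P.coeff 0) := hϖT.of_norm_eq (hcoeffT 0) h0norm
  have h0δ : spectralNorm K L (σ (P.coeff 0) - P.coeff 0) = δ :=
    le_antisymm (hle' 0) (specNorm_apply_sub_le hσ hT h0prime hϖT.mem hϖT.lt_one.le)
  have hprod : ∏ᶠ h : H₀, spectralNorm K L (σ ((h : L ≃ₐ[K] L) π) - π)
      = spectralNorm K L (((P.map s).eval πi : integers K L) : L) := by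
    have h1 : (P.map s).eval πi = ∏ h : H₀, (πi - s (h • πi)) := by
      rw [hP, MulSemiringAction.charpoly_eq, Polynomial.map_prod, Polynomial.eval_prod]
      simp
    rw [h1, SubmonoidClass.coe_finsetProd, specNorm_prod, finprod_eq_prod_of_fintype]
    refine Finset.prod_congr rfl fun h _ => ?_
    rw [specNorm_sub_comm]
    rfl
  have hdiff : (P.map s).eval πi
      = ∑ i ∈ Finset.range (P.natDegree + 1), (s (P.coeff i) - P.coeff i) * πi ^ i := by
    have h1 : P.eval πi = 0 := MulSemiringAction.eval_charpoly H₀ πi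
    rw [← sub_zero ((P.map s).eval πi), ← h1, ← Polynomial.eval_sub,
      Polynomial.eval_eq_sum_range' (n := P.natDegree + 1)]
    · simp
    · refine (Polynomial.natDegree_sub_le _ _).trans_lt ?_
      rw [Nat.lt_succ_iff]
      exact max_le Polynomial.natDegree_map_le le_rfl
  rw [hprod, ← h0δ]
  apply specNorm_eq_of_sub_lt
  rw [h0δ, hdiff, Finset.sum_range_succ', AddMemClass.coe_add, pow_zero, mul_one,
    AddSubgroupClass.coe_sub]
  change spectralNorm K L (_ + (σ (P.coeff 0) - P.coeff 0) - _) < δ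
  rw [add_sub_cancel_right, AddSubmonoidClass.coe_finsetSum]
  refine specNorm_sum_lt K _ _ hδ0 fun i _ => ?_
  change spectralNorm K L ((σ (P.coeff (i + 1)) - P.coeff (i + 1)) * π ^ (i + 1)) < δ
  rw [specNorm_mul, specNorm_pow]
  calc _ ≤ δ * spectralNorm K L π ^ (i + 1) :=
        mul_le_mul_of_nonneg_right (hle' _) (pow_nonneg hπ.pos.le _)
    _ < δ * 1 := mul_lt_mul_of_pos_left (pow_lt_one₀ hπ.pos.le hπ.lt_one i.succ_ne_zero) hδ0
    _ = δ := mul_one δ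

end Inertia

/-! ### The Artin character of the inertia group -/

section InertiaArtin

variable (K : Type*) [NontriviallyNormedField K] [IsUltrametricDist K] [CompleteSpace K]
  (L : Type*) [Field L] [Algebra K L] [Algebra.IsAlgebraic K L]

/-- The Artin character `∑_{i ≥ 0} [Γ₀ : Γ_i]⁻¹ Ind_{Γ_i}^{Γ₀} u_{Γ_i}` of the inertia group. -/
def inertiaArtinChar : ramGroup K L 0 → Qalg :=
  ∑ᶠ i : ℕ, ((ramGroup K L i).relIndex (ramGroup K L 0) : Qalg)⁻¹ • inducedAug K L i

variable {K L} in
/-- The number of ramification groups that contain `σ`; it is the value of `σ π - π` for a prime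
element `π`, and the junk value `0` for `σ = 1`. -/
def depth (σ : L ≃ₐ[K] L) : ℕ := {i | σ ∈ ramGroup K L i}.ncard

variable [FiniteDimensional K L]

theorem relIndex_ramGroup (i : ℕ) : ((ramGroup K L i).relIndex (ramGroup K L 0) : Qalg)
    = Nat.card (ramGroup K L 0) / Nat.card (ramGroup K L i) := by
  have h0 : (Nat.card (ramGroup K L i) : Qalg) ≠ 0 := by exact_mod_cast Nat.card_pos.ne'
  rw [eq_div_iff h0, ← Nat.cast_mul, ← Subgroup.relIndex_bot_left (ramGroup K L i),
    ← Subgroup.relIndex_bot_left (ramGroup K L 0), mul_comm,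
    Subgroup.relIndex_mul_relIndex _ _ _ bot_le (ramGroup_antitone K L (Nat.zero_le i))]

theorem inducedAug_apply (i : ℕ) (σ : ramGroup K L 0) : inducedAug K L i σ = open Classical in
    (if σ = 1 then (Nat.card (ramGroup K L 0) : Qalg) else 0) -
      (if (σ : L ≃ₐ[K] L) ∈ ramGroup K L i
        then (Nat.card (ramGroup K L 0) : Qalg) / Nat.card (ramGroup K L i) else 0) := by
  classical
  rw [inducedAug, pushforward_augChar _ (Subgroup.inclusion_injective _)
    (by rw [Subgroup.inclusion_range]; infer_instance)]
  simp [Subgroup.inclusion_range, Subgroup.mem_subgroupOf]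

theorem smul_inducedAug_apply (i : ℕ) (σ : ramGroup K L 0) :
    (((ramGroup K L i).relIndex (ramGroup K L 0) : Qalg)⁻¹ • inducedAug K L i) σ
      = open Classical in (if σ = 1 then (Nat.card (ramGroup K L i) : Qalg) else 0) -
        (if (σ : L ≃ₐ[K] L) ∈ ramGroup K L i then 1 else 0) := by
  have h0 : (Nat.card (ramGroup K L i) : Qalg) ≠ 0 := by exact_mod_cast Nat.card_pos.ne'
  have h1 : (Nat.card (ramGroup K L 0) : Qalg) ≠ 0 := by exact_mod_cast Nat.card_pos.ne'
  rw [Pi.smul_apply, inducedAug_apply, relIndex_ramGroup, smul_eq_mul]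
  split_ifs <;> field_simp <;> simp [mul_comm]

theorem sum_inducedAug (i : ℕ) : ∑ᶠ σ, inducedAug K L i σ = 0 :=
  pushforward_sum_eq_zero _ sum_augChar

variable [PerfectField 𝓀[K]] [IsGalois K L] [IsDiscreteValuationRing 𝒪[K]]

variable {K L} in
/-- The elements `σ ≠ 1` of `Γ₀` move a prime element `π` by an element of value `depth σ`, and lie
in `Γ_i` for `i` less than this value. -/
theorem specNorm_apply_prime_sub {π : L} (hπ : IsPrimeElt K L ⊤ π) {σ : L ≃ₐ[K] L}
    (hσ : σ ∈ ramGroup K L 0) (h1 : σ ≠ 1) :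
    spectralNorm K L (σ π - π) = spectralNorm K L π ^ depth σ ∧
      ∀ i, σ ∈ ramGroup K L i ↔ i < depth σ := by
  have hne : σ π - π ≠ 0 := fun h => h1 (eq_one_of_apply_prime hπ hσ (sub_eq_zero.1 h))
  obtain ⟨k, hk⟩ := hπ.exists_pow IntermediateField.mem_top hne
    (((mem_ramGroup_zero_iff σ).1 hσ π hπ.lt_one.le).le)
  have hmem : ∀ i, σ ∈ ramGroup K L i ↔ i < k := fun i => by
    rw [mem_ramGroup_iff_prime hπ hσ, hk, pow_le_pow_iff_right_of_lt_one₀ hπ.pos hπ.lt_one]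
    rfl
  have hd : depth σ = k := by
    unfold depth
    simp_rw [hmem]
    rw [show {i | i < k} = (Finset.range k : Set ℕ) by ext; simp, Set.ncard_coe_finset,
      Finset.card_range]
  rw [hd]
  exact ⟨hk, hmem⟩

theorem exists_ramGroup_eq_bot : ∃ N, ∀ i, N ≤ i → ramGroup K L i = ⊥ := by
  classical
  obtain ⟨π, hπ⟩ := exists_isPrimeElt K (⊤ : IntermediateField K L)
  refine ⟨Finset.univ.sup (depth : (L ≃ₐ[K] L) → ℕ), fun i hi => ?_⟩
  rw [Subgroup.eq_bot_iff_forall]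
  intro σ hσ
  by_contra h1
  have := ((specNorm_apply_prime_sub hπ (ramGroup_antitone K L (Nat.zero_le i) hσ) h1).2 i).1 hσ
  exact absurd this (not_lt.2 ((Finset.le_sup (Finset.mem_univ σ)).trans hi))

theorem exists_support_subset_range : ∃ N, 0 < N ∧ ∀ i, N ≤ i →
    inducedAug K L i = 0 ∧
      pushforward (ramGroup K L i).subtype (augChar (ramGroup K L i) Qalg) = 0 := by
  obtain ⟨N, hN⟩ := exists_ramGroup_eq_bot K L
  refine ⟨N + 1, N.succ_pos, fun i hi => ?_⟩
  have : augChar (ramGroup K L i) Qalg = 0 := by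
    have hb := hN i (Nat.le_of_succ_le hi)
    have hs : Subsingleton (ramGroup K L i) := by rw [hb]; infer_instance
    funext g
    have hg : g = 1 := Subsingleton.elim _ _
    simp [augChar, regularChar, hg]
  rw [inducedAug, this]
  exact ⟨pushforward_zero _, pushforward_zero _⟩

theorem exists_inertiaArtinChar_eq_sum : ∃ N, 0 < N ∧
    inertiaArtinChar K L = ∑ i ∈ Finset.range N,
      ((ramGroup K L i).relIndex (ramGroup K L 0) : Qalg)⁻¹ • inducedAug K L i ∧
    artinChar K L = ∑ i ∈ Finset.range N, ((ramGroup K L i).relIndex (ramGroup K L 0) : Qalg)⁻¹ •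
      pushforward (ramGroup K L i).subtype (augChar (ramGroup K L i) Qalg) ∧
    (∑ᶠ i : ℕ, ((ramGroup K L (i + 1)).relIndex (ramGroup K L 0) : Qalg)⁻¹ •
      inducedAug K L (i + 1)) = ∑ i ∈ Finset.range (N - 1),
        ((ramGroup K L (i + 1)).relIndex (ramGroup K L 0) : Qalg)⁻¹ • inducedAug K L (i + 1) ∧
    ∀ i, N ≤ i → inducedAug K L i = 0 := by
  obtain ⟨N, hN0, hN⟩ := exists_support_subset_range K L
  refine ⟨N, hN0, ?_, ?_, ?_, fun i hi => (hN i hi).1⟩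
  · refine finsum_eq_sum_of_support_subset _ fun i hi => ?_
    by_contra hlt
    exact hi (by simp [(hN i (by simpa using hlt)).1])
  · refine finsum_eq_sum_of_support_subset _ fun i hi => ?_
    by_contra hlt
    exact hi (by simp [(hN i (by simpa using hlt)).2])
  · refine finsum_eq_sum_of_support_subset _ fun i hi => ?_
    by_contra hlt
    simp only [Finset.coe_range, Set.mem_Iio, not_lt] at hlt
    exact hi (by simp [(hN (i + 1) (by omega)).1])

theorem inertiaArtinChar_apply {σ : ramGroup K L 0} (h1 : σ ≠ 1) :
    inertiaArtinChar K L σ = -(depth (σ : L ≃ₐ[K] L) : Qalg) := by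
  classical
  obtain ⟨π, hπ⟩ := exists_isPrimeElt K (⊤ : IntermediateField K L)
  obtain ⟨N, -, hsum, -, -, hN⟩ := exists_inertiaArtinChar_eq_sum K L
  have hmem := (specNorm_apply_prime_sub hπ σ.2 (fun h => h1 (Subtype.ext h))).2
  have hdN : depth (σ : L ≃ₐ[K] L) ≤ N := by
    by_contra hlt
    push Not at hlt
    have h2 := congrFun (hN N le_rfl) σ
    have h0 : (Nat.card (ramGroup K L N) : Qalg) ≠ 0 := by exact_mod_cast Nat.card_pos.ne'
    have h3 : (Nat.card (ramGroup K L 0) : Qalg) ≠ 0 := by exact_mod_cast Nat.card_pos.ne'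
    rw [inducedAug_apply, if_neg h1, if_pos ((hmem N).2 hlt), zero_sub, Pi.zero_apply,
      neg_eq_zero] at h2
    exact div_ne_zero h3 h0 h2
  rw [hsum, Finset.sum_apply]
  simp_rw [smul_inducedAug_apply, if_neg h1, zero_sub, hmem]
  rw [Finset.sum_neg_distrib, ← Finset.sum_filter, Finset.sum_const, nsmul_eq_mul, mul_one]
  have : (Finset.range N).filter (fun i => i < depth (σ : L ≃ₐ[K] L))
      = Finset.range (depth (σ : L ≃ₐ[K] L)) := by
    ext i
    simp only [Finset.mem_filter, Finset.mem_range]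
    omega
  rw [this, Finset.card_range]

theorem sum_inertiaArtinChar : ∑ᶠ σ, inertiaArtinChar K L σ = 0 := by
  obtain ⟨N, -, hsum, -, -⟩ := exists_inertiaArtinChar_eq_sum K L
  have := Fintype.ofFinite (ramGroup K L 0)
  rw [hsum, finsum_eq_sum_of_fintype]
  simp_rw [Finset.sum_apply, Pi.smul_apply]
  rw [Finset.sum_comm]
  refine Finset.sum_eq_zero fun i _ => ?_
  rw [← Finset.smul_sum, ← finsum_eq_sum_of_fintype, sum_inducedAug, smul_zero]

theorem isCentral_inertiaArtinChar : IsCentral (inertiaArtinChar K L) := by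
  obtain ⟨N, -, hsum, -, -⟩ := exists_inertiaArtinChar_eq_sum K L
  intro g h
  rw [hsum, Finset.sum_apply, Finset.sum_apply]
  refine Finset.sum_congr rfl fun i _ => ?_
  rw [Pi.smul_apply, Pi.smul_apply, inducedAug, isCentral_pushforward]

theorem conj_inertiaArtinChar : conj (inertiaArtinChar K L) = inertiaArtinChar K L := by
  ext σ
  by_cases h1 : σ = 1
  · simp [conj, h1]
  · rw [conj, inertiaArtinChar_apply K L h1, inertiaArtinChar_apply K L (inv_ne_one.2 h1)]
    simp [depth]

/-- Transitivity of induction. -/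
theorem artinChar_eq : artinChar K L
    = pushforward (ramGroup K L 0).subtype (inertiaArtinChar K L) := by
  obtain ⟨N, -, hsum, hart, -⟩ := exists_inertiaArtinChar_eq_sum K L
  rw [hsum, hart, pushforward_sum]
  refine Finset.sum_congr rfl fun i _ => ?_
  rw [pushforward_smul, inducedAug, pushforward_pushforward]
  rfl

end InertiaArtin

/-! ### Compatibility with subextensions -/

section Tower

variable (K : Type*) [NontriviallyNormedField K] [IsUltrametricDist K] [CompleteSpace K]
  [PerfectField 𝓀[K]] [IsDiscreteValuationRing 𝒪[K]]
  (M L : Type*) [Field L] [Algebra K L] [Field M] [Algebra K M] [Algebra M L]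
  [IsScalarTower K M L] [FiniteDimensional K L] [FiniteDimensional K M] [IsGalois K L]
  [IsGalois K M]

theorem restrictNormalHom_mem_ramGroup_zero {σ : L ≃ₐ[K] L} (hσ : σ ∈ ramGroup K L 0) :
    AlgEquiv.restrictNormalHom M σ ∈ ramGroup K M 0 := by
  rw [mem_ramGroup_zero_iff] at hσ ⊢
  intro x hx
  rw [spectralNorm.eq_of_tower (L := L), map_sub]
  have h : algebraMap M L (AlgEquiv.restrictNormalHom M σ x) = σ (algebraMap M L x) :=
    AlgEquiv.restrictNormal_commutes σ M x
  rw [h]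
  exact hσ _ (by rwa [← spectralNorm.eq_of_tower])

/-- The restriction `Γ₀(L/K) → Γ₀(M/K)`. -/
def inertiaRes : ramGroup K L 0 →* ramGroup K M 0 :=
  ((AlgEquiv.restrictNormalHom M).comp (ramGroup K L 0).subtype).codRestrict _
    fun σ => restrictNormalHom_mem_ramGroup_zero K M L σ.2

theorem algebraMap_inertiaRes (σ : ramGroup K L 0) (x : M) :
    algebraMap M L ((inertiaRes K M L σ : M ≃ₐ[K] M) x)
      = (σ : L ≃ₐ[K] L) (algebraMap M L x) :=
  AlgEquiv.restrictNormal_commutes (σ : L ≃ₐ[K] L) M x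

theorem mem_fixedField_ker_iff (x : L) : x ∈ IntermediateField.fixedField
    (AlgEquiv.restrictNormalHom M : (L ≃ₐ[K] L) →* (M ≃ₐ[K] M)).ker ↔
      x ∈ Set.range (algebraMap M L) := by
  rw [IntermediateField.mem_fixedField_iff]
  constructor
  · intro h
    have : IsGalois M L := IsGalois.tower_top_of_isGalois K M L
    have : FiniteDimensional M L := FiniteDimensional.right K M L
    rw [IsGalois.mem_range_algebraMap_iff_fixed]
    intro f
    refine h (f.restrictScalars K) ?_
    rw [MonoidHom.mem_ker]
    ext y
    apply (algebraMap M L).injective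
    exact (AlgEquiv.restrictNormal_commutes (f.restrictScalars K) M y).trans (f.commutes y)
  · rintro ⟨y, rfl⟩ σ hσ
    have h := AlgEquiv.restrictNormal_commutes σ M y
    rw [MonoidHom.mem_ker] at hσ
    rw [← h]
    exact congrArg (algebraMap M L) (DFunLike.congr_fun hσ y)

variable {K M L}

theorem IsPrimeElt.algebraMap {ϖ : M} (hϖ : IsPrimeElt K M ⊤ ϖ) :
    IsPrimeElt K L (IntermediateField.fixedField
      (AlgEquiv.restrictNormalHom M : (L ≃ₐ[K] L) →* (M ≃ₐ[K] M)).ker) (algebraMap M L ϖ) where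
  mem := (mem_fixedField_ker_iff K M L _).2 ⟨ϖ, rfl⟩
  ne_zero := by simpa using hϖ.ne_zero
  lt_one := by
    rw [← spectralNorm.eq_of_tower]
    exact hϖ.lt_one
  exists_zpow x hx hx0 := by
    obtain ⟨y, rfl⟩ := (mem_fixedField_ker_iff K M L _).1 hx
    rw [← spectralNorm.eq_of_tower, ← spectralNorm.eq_of_tower]
    exact hϖ.exists_zpow y IntermediateField.mem_top (by simpa using hx0)

variable (K M L)

/-- The kernel of `Γ₀(L/K) → Γ₀(M/K)` is the inertia group of `L/M`. -/
def kerInertiaResEquiv : (inertiaRes K M L).ker ≃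
    ↥((AlgEquiv.restrictNormalHom M : (L ≃ₐ[K] L) →* (M ≃ₐ[K] M)).ker ⊓ ramGroup K L 0) where
  toFun k := ⟨k.1.1, congrArg Subtype.val (MonoidHom.mem_ker.1 k.2), k.1.2⟩
  invFun h := ⟨⟨h.1, h.2.2⟩, MonoidHom.mem_ker.2 (Subtype.ext h.2.1)⟩
  left_inv _ := rfl
  right_inv _ := rfl

variable {K M L}

theorem specNorm_algebraMap_prime {ϖ : M} {π : L} (hϖ : IsPrimeElt K M ⊤ ϖ)
    (hπ : IsPrimeElt K L ⊤ π) :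
    spectralNorm K L (algebraMap M L ϖ)
      = spectralNorm K L π ^ Nat.card (inertiaRes K M L).ker := by
  rw [specNorm_prime_fixedField hπ hϖ.algebraMap, Nat.card_congr (kerInertiaResEquiv K M L)]

variable (L) in
theorem isPrimeElt_algebraMap_base (ϖ : K) (h0 : ϖ ≠ 0) (h1 : ‖ϖ‖ < 1)
    (hz : ∀ x : K, x ≠ 0 → ∃ k : ℤ, ‖x‖ = ‖ϖ‖ ^ k) :
    IsPrimeElt K L (IntermediateField.fixedField ⊤) (algebraMap K L ϖ) where
  mem := (IntermediateField.fixedField ⊤).algebraMap_mem ϖ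
  ne_zero := by simpa using h0
  lt_one := by rwa [spectralNorm_extends]
  exists_zpow x hx hx0 := by
    obtain ⟨y, rfl⟩ := (IsGalois.mem_range_algebraMap_iff_fixed x).2 fun f =>
      (IntermediateField.mem_fixedField_iff _ _).1 hx f (Subgroup.mem_top f)
    rw [spectralNorm_extends, spectralNorm_extends]
    exact hz y (by simpa using hx0)

variable (K M L)

theorem card_inertia_eq : Nat.card (ramGroup K L 0)
    = Nat.card (inertiaRes K M L).ker * Nat.card (ramGroup K M 0) := by
  obtain ⟨ϖ, h0, h1, hz⟩ := exists_uniformizer_base K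
  obtain ⟨π, hπ⟩ := exists_isPrimeElt K (⊤ : IntermediateField K L)
  obtain ⟨ρ, hρ⟩ := exists_isPrimeElt K (⊤ : IntermediateField K M)
  have hL := specNorm_prime_fixedField hπ (isPrimeElt_algebraMap_base L ϖ h0 h1 hz)
  have hM := specNorm_prime_fixedField hρ (isPrimeElt_algebraMap_base M ϖ h0 h1 hz)
  rw [spectralNorm_extends, top_inf_eq] at hL hM
  rw [hM, spectralNorm.eq_of_tower (L := L), specNorm_algebraMap_prime hρ hπ, ← pow_mul] at hL
  exact le_antisymm ((pow_le_pow_iff_right_of_lt_one₀ hπ.pos hπ.lt_one).1 hL.le)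
    ((pow_le_pow_iff_right_of_lt_one₀ hπ.pos hπ.lt_one).1 hL.ge)

/-- The inertia group of `L/K` maps onto that of `M/K`, by comparison of ramification indices. -/
theorem inertiaRes_surjective : Function.Surjective (inertiaRes K M L) := by
  rw [← MonoidHom.range_eq_top]
  apply Subgroup.eq_top_of_card_eq
  have h := Subgroup.card_mul_index (inertiaRes K M L).ker
  rw [Subgroup.index_ker, card_inertia_eq K M L] at h
  exact Nat.eq_of_mul_eq_mul_left Nat.card_pos h

/-- The depth of an element of `Γ₀(M/K)` is the average of the depths of its lifts to
`Γ₀(L/K)`. -/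
theorem sum_depth (σ : ramGroup K L 0) (h1 : inertiaRes K M L σ ≠ 1) :
    ∑ᶠ k : (inertiaRes K M L).ker, depth ((σ * k : ramGroup K L 0) : L ≃ₐ[K] L)
      = Nat.card (inertiaRes K M L).ker * depth (inertiaRes K M L σ : M ≃ₐ[K] M) := by
  classical
  have := Fintype.ofFinite (inertiaRes K M L).ker
  obtain ⟨π, hπ⟩ := exists_isPrimeElt K (⊤ : IntermediateField K L)
  obtain ⟨ρ, hρ⟩ := exists_isPrimeElt K (⊤ : IntermediateField K M)
  have hs1 : (inertiaRes K M L σ : M ≃ₐ[K] M) ≠ 1 := fun h => h1 (Subtype.ext h)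
  have hM := (specNorm_apply_prime_sub hρ (inertiaRes K M L σ).2 hs1).1
  have hmap : algebraMap M L ((inertiaRes K M L σ : M ≃ₐ[K] M) ρ - ρ)
      = (σ : L ≃ₐ[K] L) (algebraMap M L ρ) - algebraMap M L ρ := by
    rw [map_sub, algebraMap_inertiaRes]
  rw [spectralNorm.eq_of_tower (E := M) (L := L), hmap, spectralNorm.eq_of_tower (E := M) (L := L),
    specNorm_algebraMap_prime hρ hπ, ← pow_mul, ← prod_specNorm_apply_sub hπ hρ.algebraMap σ.2,
    ← finprod_comp_equiv (kerInertiaResEquiv K M L), finprod_eq_prod_of_fintype] at hM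
  · have hL : ∀ k : (inertiaRes K M L).ker,
        spectralNorm K L ((σ : L ≃ₐ[K] L) ((kerInertiaResEquiv K M L k : L ≃ₐ[K] L) π) - π)
          = spectralNorm K L π ^ depth ((σ * k : ramGroup K L 0) : L ≃ₐ[K] L) := by
      intro k
      refine (specNorm_apply_prime_sub hπ (σ * k : ramGroup K L 0).2 fun h => h1 ?_).1
      have h2 : inertiaRes K M L (σ * k) = 1 := by
        rw [show (σ * k : ramGroup K L 0) = 1 from Subtype.ext h, map_one]
      rwa [map_mul, MonoidHom.mem_ker.1 k.2, mul_one] at h2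
    simp_rw [hL] at hM
    rw [Finset.prod_pow_eq_pow_sum] at hM
    rw [finsum_eq_sum_of_fintype]
    exact le_antisymm ((pow_le_pow_iff_right_of_lt_one₀ hπ.pos hπ.lt_one).1 hM.ge)
      ((pow_le_pow_iff_right_of_lt_one₀ hπ.pos hπ.lt_one).1 hM.le)
  · intro h
    refine hs1 (eq_one_of_apply_prime hρ (inertiaRes K M L σ).2 ((algebraMap M L).injective ?_))
    rw [algebraMap_inertiaRes, h]

theorem pushforward_inertiaArtinChar :
    pushforward (inertiaRes K M L) (inertiaArtinChar K L) = inertiaArtinChar K M := by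
  refine eq_of_forall_ne_one ?_ ?_
  · intro s hs
    obtain ⟨σ, rfl⟩ := inertiaRes_surjective K M L s
    have hcard : (Nat.card (inertiaRes K M L).ker : Qalg) ≠ 0 := by exact_mod_cast Nat.card_pos.ne'
    have := Fintype.ofFinite (inertiaRes K M L).ker
    have hval : ∀ k : (inertiaRes K M L).ker, inertiaArtinChar K L (σ * k)
        = -(depth ((σ * k : ramGroup K L 0) : L ≃ₐ[K] L) : Qalg) := by
      intro k
      refine inertiaArtinChar_apply K L fun h => hs ?_
      have h2 : inertiaRes K M L (σ * k) = 1 := by rw [h, map_one]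
      rwa [map_mul, MonoidHom.mem_ker.1 k.2, mul_one] at h2
    have hsum := sum_depth K M L σ hs
    rw [pushforward_of_surjective _ (inertiaRes_surjective K M L)
      (isCentral_inertiaArtinChar K L), inertiaArtinChar_apply K M hs]
    simp_rw [hval]
    rw [finsum_eq_sum_of_fintype] at hsum ⊢
    rw [Finset.sum_neg_distrib, ← Nat.cast_sum, hsum]
    push_cast
    field_simp
  · rw [pushforward_sum_eq_zero _ (sum_inertiaArtinChar K L), sum_inertiaArtinChar]

end Tower

/-! ### The residue classes of `σ x / x` -/

section TameRes

variable {K : Type*} [NontriviallyNormedField K] [IsUltrametricDist K] [CompleteSpace K]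
  (Ω : Type*) [Field Ω] [Algebra K Ω] [Algebra.IsAlgebraic K Ω]
  {L : Type*} [Field L] [Algebra K L] [Algebra.IsAlgebraic K L] [Algebra L Ω] [IsScalarTower K L Ω]

/-- The residue class of `σ x / x` in the residue field of an algebraic extension `Ω` of `L`. -/
def tameRes (σ : L ≃ₐ[K] L) (x : L) : ResidueAlg K Ω :=
  IsLocalRing.residue (integers K Ω) ⟨algebraMap L Ω (σ x / x), by
    rw [mem_integers_iff, ← spectralNorm.eq_of_tower, specNorm_div, specNorm_algEquiv]
    exact div_self_le_one _⟩

variable {Ω}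

theorem tameRes_eq_one_iff {σ : L ≃ₐ[K] L} {x : L} (hx : x ≠ 0) :
    tameRes Ω σ x = 1 ↔ spectralNorm K L (σ x - x) < spectralNorm K L x := by
  rw [← map_one (IsLocalRing.residue (integers K Ω)), tameRes, residue_eq_iff, OneMemClass.coe_one,
    ← map_one (algebraMap L Ω), ← map_sub, ← spectralNorm.eq_of_tower, div_sub_one hx,
    specNorm_div, div_lt_one (specNorm_pos K hx)]

theorem tameRes_mul (σ : L ≃ₐ[K] L) (x y : L) :
    tameRes Ω σ (x * y) = tameRes Ω σ x * tameRes Ω σ y := by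
  rw [tameRes, tameRes, tameRes, ← map_mul]
  congr 1
  apply Subtype.ext
  simp [mul_div_mul_comm]

theorem tameRes_of_specNorm_eq_one {σ : L ≃ₐ[K] L} (hσ : σ ∈ ramGroup K L 0) {x : L}
    (hx : spectralNorm K L x = 1) : tameRes Ω σ x = 1 := by
  have hx0 : x ≠ 0 := fun h => by
    rw [h, spectralNorm_zero] at hx
    exact zero_ne_one hx
  rw [tameRes_eq_one_iff hx0, hx]
  exact (mem_ramGroup_zero_iff σ).1 hσ x hx.le

/-- For `σ` in the inertia group, the residue class of `σ x / x` depends only on the value of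
`x`. -/
theorem tameRes_congr {σ : L ≃ₐ[K] L} (hσ : σ ∈ ramGroup K L 0) {x y : L} (hy : y ≠ 0)
    (h : spectralNorm K L x = spectralNorm K L y) : tameRes Ω σ x = tameRes Ω σ y := by
  have h1 : x = y * (x / y) := (mul_div_cancel₀ x hy).symm
  have h2 : tameRes Ω σ (x / y) = 1 := tameRes_of_specNorm_eq_one hσ (by
    rw [specNorm_div, h, div_self (specNorm_pos K hy).ne'])
  rw [h1, tameRes_mul, h2, mul_one]

theorem tameRes_mul_left {σ : L ≃ₐ[K] L} (hσ : σ ∈ ramGroup K L 0) (τ : L ≃ₐ[K] L) {x : L}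
    (hx : x ≠ 0) : tameRes Ω (σ * τ) x = tameRes Ω σ x * tameRes Ω τ x := by
  rw [← tameRes_congr hσ hx (specNorm_algEquiv K τ x), tameRes, tameRes, tameRes, ← map_mul]
  congr 1
  apply Subtype.ext
  have h0 : algebraMap L Ω (τ x) ≠ 0 := by simpa using hx
  simp [AlgEquiv.mul_apply, div_mul_div_cancel₀ h0]

theorem tameRes_one {x : L} (hx : x ≠ 0) : tameRes Ω (1 : L ≃ₐ[K] L) x = 1 := by
  rw [tameRes_eq_one_iff hx]
  simpa [spectralNorm_zero] using specNorm_pos K hx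

theorem tameRes_pow (σ : L ≃ₐ[K] L) (x : L) (n : ℕ) :
    tameRes Ω σ (x ^ n) = tameRes Ω σ x ^ n := by
  induction n with
  | zero =>
    rw [pow_zero, pow_zero, tameRes_eq_one_iff one_ne_zero, map_one, sub_self, spectralNorm_zero,
      specNorm_one]
    exact one_pos
  | succ n ih => rw [pow_succ, pow_succ, tameRes_mul, ih]

variable (Ω) in
/-- The character `σ ↦ σ x / x` of the inertia group with values in the residue field. -/
def tameResHom {x : L} (hx : x ≠ 0) : ramGroup K L 0 →* ResidueAlg K Ω where
  toFun σ := tameRes Ω (σ : L ≃ₐ[K] L) x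
  map_one' := tameRes_one hx
  map_mul' σ τ := tameRes_mul_left σ.2 τ hx

theorem natCast_residue_eq_zero_iff (n : ℕ) :
    (n : ResidueAlg K Ω) = 0 ↔ ‖(n : K)‖ < 1 := by
  rw [← map_natCast (IsLocalRing.residue (integers K Ω)), IsLocalRing.residue_eq_zero_iff,
    mem_maximalIdeal_integers, ← spectralNorm_extends (K := K) (L := Ω)]
  simp

variable [PerfectField 𝓀[K]] [FiniteDimensional K L]

theorem tameRes_prime_eq_one_iff {π : L} (hπ : IsPrimeElt K L ⊤ π) {σ : L ≃ₐ[K] L}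
    (hσ : σ ∈ ramGroup K L 0) : tameRes Ω σ π = 1 ↔ σ ∈ ramGroup K L 1 := by
  rw [tameRes_eq_one_iff hπ.ne_zero, mem_ramGroup_iff_prime hπ hσ]
  constructor
  · intro h
    have h1 : spectralNorm K L ((σ π - π) / π) < 1 := by
      rwa [specNorm_div, div_lt_one hπ.pos]
    have h2 := hπ.le_of_lt_one IntermediateField.mem_top h1
    rw [specNorm_div, div_le_iff₀ hπ.pos] at h2
    rwa [pow_two]
  · intro h
    refine h.trans_lt ?_
    rw [pow_two]
    exact mul_lt_of_lt_one_left hπ.pos hπ.lt_one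

/-- Elements of the wild inertia group move every `x ≠ 0` by an element of larger value. -/
theorem specNorm_sub_lt_of_mem_ramGroup_one {π : L} (hπ : IsPrimeElt K L ⊤ π) {σ : L ≃ₐ[K] L}
    (hσ : σ ∈ ramGroup K L 1) {x : L} (hx : x ≠ 0) :
    spectralNorm K L (σ x - x) < spectralNorm K L x := by
  have hσ0 := ramGroup_antitone K L (Nat.zero_le 1) hσ
  have hint : ∀ x : L, x ≠ 0 → spectralNorm K L x ≤ 1 →
      spectralNorm K L (σ x - x) < spectralNorm K L x := by
    intro x hx h1
    obtain ⟨k, hk⟩ := hπ.exists_pow IntermediateField.mem_top hx h1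
    rw [← tameRes_eq_one_iff (Ω := L) hx, tameRes_congr hσ0 (pow_ne_zero k hπ.ne_zero)
      (by rw [hk, specNorm_pow]), tameRes_pow σ π,
      (tameRes_prime_eq_one_iff hπ hσ0).2 hσ, one_pow]
  rcases le_total (spectralNorm K L x) 1 with h1 | h1
  · exact hint x hx h1
  · have h2 := (tameRes_eq_one_iff (Ω := L) (inv_ne_zero hx)).2 (hint x⁻¹ (inv_ne_zero hx)
      (by rw [specNorm_inv]; exact inv_le_one_of_one_le₀ h1))
    have h3 := tameRes_mul (Ω := L) σ x x⁻¹
    rw [mul_inv_cancel₀ hx, tameRes_of_specNorm_eq_one hσ0 (specNorm_one K), h2, mul_one] at h3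
    exact (tameRes_eq_one_iff hx).1 h3.symm

variable [IsGalois K L] [IsDiscreteValuationRing 𝒪[K]]

variable (K L) in
/-- The prime divisors of `|Γ₁|` vanish in the residue field: if `σ ∈ Γ₁` moves a prime element `π`
by `δ`, then `σ^k π - π` is `k δ` up to an element of larger value. -/
theorem norm_natCast_lt_one_of_dvd_card {l : ℕ} (hl : l.Prime)
    (hd : l ∣ Nat.card (ramGroup K L 1)) : ‖(l : K)‖ < 1 := by
  have := Fact.mk hl
  obtain ⟨π, hπ⟩ := exists_isPrimeElt K (⊤ : IntermediateField K L)
  obtain ⟨σ, hσ⟩ := exists_prime_orderOf_dvd_card' (G := ramGroup K L 1) l hd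
  have hσ0 := ramGroup_antitone K L (Nat.zero_le 1) σ.2
  set τ : L ≃ₐ[K] L := σ.1
  set δ := τ π - π with hδ
  have hδ0 : δ ≠ 0 := fun h => by
    have h1 : τ = 1 := eq_one_of_apply_prime hπ hσ0 (sub_eq_zero.1 h)
    have h2 : σ = 1 := Subtype.ext h1
    rw [h2, orderOf_one] at hσ
    exact hl.one_lt.ne hσ
  have hδp := specNorm_pos K hδ0
  have key : ∀ k : ℕ, spectralNorm K L ((τ ^ k) π - π - k * δ) < spectralNorm K L δ := by
    intro k
    induction k with
    | zero => simpa [spectralNorm_zero] using hδp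
    | succ k ih =>
      have h1 : (τ ^ (k + 1)) π - π - ((k + 1 : ℕ) : L) * δ
          = τ ((τ ^ k) π - π - k * δ) + k * (τ δ - δ) := by
        rw [pow_succ', AlgEquiv.mul_apply, map_sub, map_sub, map_mul, map_natCast]
        push_cast
        rw [hδ]
        ring
      rw [h1]
      refine (specNorm_add_le K _ _).trans_lt (max_lt ?_ ?_)
      · rwa [specNorm_algEquiv]
      · rw [specNorm_mul]
        have hk : spectralNorm K L (k : L) ≤ 1 := by
          rw [← map_natCast (algebraMap K L), spectralNorm_extends]
          exact IsUltrametricDist.norm_natCast_le_one K k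
        exact (mul_le_of_le_one_left (specNorm_nonneg K _) hk).trans_lt
          (specNorm_sub_lt_of_mem_ramGroup_one hπ σ.2 hδ0)
  have h1 := key l
  have h2 : τ ^ l = 1 := by
    have h3 := congrArg Subtype.val (pow_orderOf_eq_one σ)
    rw [hσ] at h3
    simpa using h3
  rw [h2, AlgEquiv.one_apply, sub_self, zero_sub, specNorm_neg, specNorm_mul,
    ← map_natCast (algebraMap K L), spectralNorm_extends] at h1
  exact (mul_lt_iff_lt_one_left hδp).1 h1

theorem ramGroup_zero_pow_tameDegree_mem {σ : L ≃ₐ[K] L} (hσ : σ ∈ ramGroup K L 0) :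
    σ ^ tameDegree K L ∈ ramGroup K L 1 :=
  Subgroup.mem_subgroupOf.1 (((ramGroup K L 1).subgroupOf (ramGroup K L 0)).pow_index_mem ⟨σ, hσ⟩)

variable (K L) in
/-- The prime divisors of `|Γ₀/Γ₁|` do not vanish in the residue field, since `Γ₀/Γ₁` embeds into
the multiplicative group of a field. -/
theorem not_norm_natCast_lt_one_of_dvd_tameDegree {l : ℕ} (hl : l.Prime)
    (hd : l ∣ tameDegree K L) : ¬ ‖(l : K)‖ < 1 := by
  intro h
  have := Fact.mk hl
  obtain ⟨π, hπ⟩ := exists_isPrimeElt K (⊤ : IntermediateField K L)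
  set N := (ramGroup K L 1).subgroupOf (ramGroup K L 0) with hN
  obtain ⟨q, hq⟩ := exists_prime_orderOf_dvd_card' (G := ramGroup K L 0 ⧸ N) l hd
  induction q using QuotientGroup.induction_on with
  | H σ =>
    have h1 : σ ^ l ∈ N := by
      rw [← QuotientGroup.eq_one_iff, QuotientGroup.mk_pow, ← hq, pow_orderOf_eq_one]
    have h2 : tameResHom L hπ.ne_zero σ ^ l = 1 := by
      rw [← map_pow]
      exact (tameRes_prime_eq_one_iff hπ (σ ^ l).2).2 (Subgroup.mem_subgroupOf.1 h1)
    have h0 : (l : ResidueAlg K L) = 0 := (natCast_residue_eq_zero_iff l).2 h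
    have hchar : CharP (ResidueAlg K L) l := CharP.ringChar_of_prime_eq_zero hl h0 ▸ inferInstance
    have h3 : (tameResHom L hπ.ne_zero σ - 1) ^ l = 0 := by
      rw [sub_pow_char, h2, one_pow, sub_self]
    have h4 : tameRes L (σ : L ≃ₐ[K] L) π = 1 := sub_eq_zero.1 (pow_eq_zero_iff hl.ne_zero |>.1 h3)
    have h5 : (σ : ramGroup K L 0 ⧸ N) = 1 := (QuotientGroup.eq_one_iff σ).2
      (Subgroup.mem_subgroupOf.2 ((tameRes_prime_eq_one_iff hπ σ.2).1 h4))
    rw [h5, orderOf_one] at hq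
    exact hl.one_lt.ne hq

theorem tameDegree_ne_zero : tameDegree K L ≠ 0 :=
  Subgroup.index_ne_zero_of_finite

/-- Tame and wild ramification indices of any two extensions are coprime. -/
theorem coprime_tameDegree_card (K : Type*) [NontriviallyNormedField K] [IsUltrametricDist K]
    [CompleteSpace K] [PerfectField 𝓀[K]] [IsDiscreteValuationRing 𝒪[K]]
    (L M : Type*) [Field L] [Algebra K L] [Field M] [Algebra K M] [FiniteDimensional K L]
    [FiniteDimensional K M] [IsGalois K L] [IsGalois K M] :
    Nat.Coprime (tameDegree K L) (Nat.card (ramGroup K M 1)) :=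
  Nat.coprime_of_dvd fun _ hl h1 h2 => not_norm_natCast_lt_one_of_dvd_tameDegree K L hl h1
    (norm_natCast_lt_one_of_dvd_card K M hl h2)

variable (K Ω L) in
theorem tameDegree_residue_ne_zero : (tameDegree K L : ResidueAlg K Ω) ≠ 0 := by
  rw [← Nat.prod_primeFactorsList (tameDegree_ne_zero (K := K) (L := L)), Nat.cast_list_prod]
  refine List.prod_ne_zero fun h => ?_
  obtain ⟨l, hl, h0⟩ := List.mem_map.1 h
  exact not_norm_natCast_lt_one_of_dvd_tameDegree K L (Nat.prime_of_mem_primeFactorsList hl)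
    (Nat.dvd_of_mem_primeFactorsList hl) ((natCast_residue_eq_zero_iff l).1 h0)

end TameRes

/-! ### Teichmüller lifts of roots of unity -/

section Corresponds

variable {K : Type*} [NontriviallyNormedField K] [IsUltrametricDist K] [CompleteSpace K]
  {Kalg : Type*} [Field Kalg] [Algebra K Kalg] [Algebra.IsAlgebraic K Kalg]
  (e : RootEmbedding K Kalg)

theorem RootEmbedding.corresponds_one : e.Corresponds 1 1 := by
  cases e with
  | charZero j =>
    refine ⟨by simp, ?_⟩
    rw [← map_one (IsLocalRing.residue (integers K Kalg))]
    congr 1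
    exact Subtype.ext (map_one j)
  | charP p j => simp [RootEmbedding.Corresponds]

variable {e}

theorem RootEmbedding.Corresponds.mul {ζ ξ : Qalg} {x y : ResidueAlg K Kalg}
    (h : e.Corresponds ζ x) (h' : e.Corresponds ξ y) : e.Corresponds (ζ * ξ) (x * y) := by
  cases e with
  | charZero j =>
    obtain ⟨h1, rfl⟩ := h
    obtain ⟨h2, rfl⟩ := h'
    exact ⟨(map_mul j ζ ξ).symm ▸ mul_mem h1 h2,
      (congrArg (IsLocalRing.residue (integers K Kalg)) (Subtype.ext (map_mul j ζ ξ))).trans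
        (map_mul (IsLocalRing.residue (integers K Kalg)) ⟨j ζ, h1⟩ ⟨j ξ, h2⟩)⟩
  | charP p j =>
    simp only [RootEmbedding.Corresponds] at h h' ⊢
    rw [map_mul, h, h', map_mul, map_mul, map_mul]

theorem RootEmbedding.Corresponds.pow {ζ : Qalg} {x : ResidueAlg K Kalg}
    (h : e.Corresponds ζ x) (n : ℕ) : e.Corresponds (ζ ^ n) (x ^ n) := by
  induction n with
  | zero => simpa using e.corresponds_one
  | succ n ih => rw [pow_succ, pow_succ]; exact ih.mul h

theorem RootEmbedding.Corresponds.unique_right {ζ : Qalg} {x y : ResidueAlg K Kalg}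
    (h : e.Corresponds ζ x) (h' : e.Corresponds ζ y) : x = y := by
  cases e with
  | charZero j =>
    obtain ⟨h1, rfl⟩ := h
    obtain ⟨h2, rfl⟩ := h'
    rfl
  | charP p j =>
    simp only [RootEmbedding.Corresponds] at h h'
    rw [h] at h'
    have h1 := IsFractionRing.injective (WittVector p (ResidueAlg K Kalg))
      (FractionRing (WittVector p (ResidueAlg K Kalg))) ((algebraMap _ _).injective h')
    have h2 := congrArg (fun w => WittVector.coeff w 0) h1
    simpa [WittVector.teichmuller_coeff_zero] using h2

theorem pow_sub_one_eq_prod {B : Type*} [CommRing B] [IsDomain B] (j : Qalg →+* B) {n : ℕ}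
    (hn : n ≠ 0) (y : B) :
    y ^ n - 1 = ∏ ζ ∈ Polynomial.nthRootsFinset n (1 : Qalg), (y - j ζ) := by
  have : NeZero (n : Qalg) := ⟨by exact_mod_cast hn⟩
  obtain ⟨ξ, hξ⟩ := HasEnoughRootsOfUnity.exists_primitiveRoot Qalg n
  have h := congrArg (fun P : Polynomial Qalg => (P.map j).eval y)
    (Polynomial.X_pow_sub_one_eq_prod (Nat.pos_of_ne_zero hn) hξ)
  simpa [Polynomial.map_prod, Polynomial.eval_prod] using h

theorem RootEmbedding.exists_corresponds (e : RootEmbedding K Kalg) {n : ℕ} (hn : n ≠ 0)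
    {x : ResidueAlg K Kalg} (hx : x ^ n = 1) :
    ∃ ζ : rootsOfUnity n Qalg, e.Corresponds ((ζ : Qalgˣ) : Qalg) x := by
  have hmk : ∀ ζ ∈ Polynomial.nthRootsFinset n (1 : Qalg), e.Corresponds ζ x →
      ∃ ζ : rootsOfUnity n Qalg, e.Corresponds ((ζ : Qalgˣ) : Qalg) x := fun ζ hζ h => by
    have : NeZero n := ⟨hn⟩
    exact ⟨rootsOfUnity.mkOfPowEq ζ
      ((Polynomial.mem_nthRootsFinset (Nat.pos_of_ne_zero hn) _).1 hζ), by simpa using h⟩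
  cases e with
  | charZero j =>
    obtain ⟨y, rfl⟩ := IsLocalRing.residue_surjective x
    have hint : ∀ ζ ∈ Polynomial.nthRootsFinset n (1 : Qalg), j ζ ∈ integers K Kalg := by
      intro ζ hζ
      have h1 := (Polynomial.mem_nthRootsFinset (Nat.pos_of_ne_zero hn) _).1 hζ
      have h2 := congrArg (spectralNorm K Kalg) (congrArg j h1)
      rw [map_pow, specNorm_pow, map_one, specNorm_one] at h2
      exact ((pow_eq_one_iff_of_nonneg (specNorm_nonneg K _) hn).1 h2).le
    have hprod := congrArg (spectralNorm K Kalg) (pow_sub_one_eq_prod j hn (y : Kalg))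
    rw [specNorm_prod] at hprod
    have hlt : spectralNorm K Kalg ((y : Kalg) ^ n - 1) < 1 := by
      rw [← map_pow, ← map_one (IsLocalRing.residue (integers K Kalg)), residue_eq_iff] at hx
      simpa using hx
    obtain ⟨ζ, hζ, hζ1⟩ : ∃ ζ ∈ Polynomial.nthRootsFinset n (1 : Qalg),
        spectralNorm K Kalg ((y : Kalg) - j ζ) < 1 := by
      by_contra hcon
      push Not at hcon
      rw [hprod] at hlt
      exact absurd hlt (not_lt.2 (by
        simpa using Finset.prod_le_prod (fun _ _ => zero_le_one' ℝ) hcon))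
    refine hmk ζ hζ ⟨hint ζ hζ, ?_⟩
    rw [residue_eq_iff, specNorm_sub_comm]
    exact hζ1
  | charP p j =>
    set t := algebraMap (FractionRing (WittVector p (ResidueAlg K Kalg)))
      (AlgebraicClosure (FractionRing (WittVector p (ResidueAlg K Kalg))))
      (algebraMap (WittVector p (ResidueAlg K Kalg)) _ (WittVector.teichmuller p x)) with ht
    have ht1 : t ^ n - 1 = 0 := by
      rw [ht, ← map_pow, ← map_pow, ← map_pow, hx, map_one, map_one, map_one, sub_self]
    rw [pow_sub_one_eq_prod j hn, Finset.prod_eq_zero_iff] at ht1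
    obtain ⟨ζ, hζ, h0⟩ := ht1
    exact hmk ζ hζ (sub_eq_zero.1 h0).symm

/-- Roots of unity of order prime to the residue characteristic are determined by their residue
classes. -/
theorem RootEmbedding.Corresponds.unique_left {n : ℕ} (hn : (n : ResidueAlg K Kalg) ≠ 0)
    {ζ ξ : Qalg} (hζ : ζ ^ n = 1) (hξ : ξ ^ n = 1) {x : ResidueAlg K Kalg}
    (h : e.Corresponds ζ x) (h' : e.Corresponds ξ x) : ζ = ξ := by
  have hn0 : n ≠ 0 := by
    rintro rfl
    simp at hn
  cases e with
  | charZero j =>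
    obtain ⟨h1, hx1⟩ := h
    obtain ⟨h2, hx2⟩ := h'
    by_contra hne
    have hξ0 : ξ ≠ 0 := fun h0 => by
      rw [h0, zero_pow hn0] at hξ
      exact zero_ne_one hξ
    set η := ζ / ξ with hη
    have hη1 : η ≠ 1 := fun h0 => hne ((div_eq_one_iff_eq hξ0).1 h0)
    have hηn : η ^ n = 1 := by rw [hη, div_pow, hζ, hξ, div_one]
    have hξn : spectralNorm K Kalg (j ξ) = 1 := by
      have h2 := congrArg (spectralNorm K Kalg) (congrArg j hξ)
      rw [map_pow, specNorm_pow, map_one, specNorm_one] at h2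
      exact (pow_eq_one_iff_of_nonneg (specNorm_nonneg K _) hn0).1 h2
    have hlt : spectralNorm K Kalg (j η - 1) < 1 := by
      rw [← hx2, residue_eq_iff] at hx1
      have h3 : j η - 1 = (j ζ - j ξ) / j ξ := by
        rw [hη, map_div₀, sub_div, div_self (by simpa using hξ0)]
      rw [h3, specNorm_div, hξn, div_one]
      exact hx1
    have hηi : spectralNorm K Kalg (j η) ≤ 1 := by
      have := specNorm_add_le K (j η - 1) 1
      rw [sub_add_cancel, specNorm_one] at this
      exact this.trans (max_le hlt.le le_rfl)
    set y : integers K Kalg := ⟨j η, hηi⟩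
    have hy : IsLocalRing.residue (integers K Kalg) y = 1 := by
      rw [← map_one (IsLocalRing.residue (integers K Kalg)), residue_eq_iff]
      exact hlt
    -- `1 + η + ⋯ + η^{n-1}` vanishes and is congruent to `n`.
    have hsum : ∑ i ∈ Finset.range n, y ^ i = 0 := by
      apply Subtype.ext
      have h4 := geom_sum_mul η n
      rw [hηn, sub_self] at h4
      have h5 := congrArg j ((mul_eq_zero.1 h4).resolve_right (sub_ne_zero.2 hη1))
      rw [map_sum, map_zero] at h5
      rw [AddSubmonoidClass.coe_finsetSum]
      simpa [y] using h5
    have h6 := congrArg (IsLocalRing.residue (integers K Kalg)) hsum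
    rw [map_sum, map_zero] at h6
    simp_rw [map_pow, hy, one_pow] at h6
    exact hn (by simpa using h6)
  | charP p j =>
    simp only [RootEmbedding.Corresponds] at h h'
    exact j.injective (h.trans h'.symm)

end Corresponds

/-! ### The tame character -/

section TameChar

variable {K : Type*} [NontriviallyNormedField K] [IsUltrametricDist K] [CompleteSpace K]
  [PerfectField 𝓀[K]] [IsDiscreteValuationRing 𝒪[K]]
  {Kalg : Type*} [Field Kalg] [Algebra K Kalg] [Algebra.IsAlgebraic K Kalg]
  (e : RootEmbedding K Kalg) (L : IntermediateField K Kalg) [FiniteDimensional K L] [IsGalois K L]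

theorem tameDegree_mul_card (K : Type*) [NontriviallyNormedField K] [IsUltrametricDist K]
    [CompleteSpace K] (L : Type*) [Field L] [Algebra K L] [Algebra.IsAlgebraic K L] :
    tameDegree K L * Nat.card (ramGroup K L 1) = Nat.card (ramGroup K L 0) := by
  rw [← Subgroup.relIndex_bot_left (ramGroup K L 1), ← Subgroup.relIndex_bot_left (ramGroup K L 0),
    mul_comm]
  exact Subgroup.relIndex_mul_relIndex _ _ _ bot_le (ramGroup_antitone K L (Nat.zero_le 1))

variable {L} in
theorem isUniformizer_tameField_iff {ρ : L} (hρ : IsPrimeElt K L (tameField K L) ρ)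
    (π : integers K (tameField K L)) : IsUniformizer K (tameField K L) π ↔
      spectralNorm K L ((π : tameField K L) : L) = spectralNorm K L ρ := by
  have hn : ∀ x : tameField K L, spectralNorm K (tameField K L) x = spectralNorm K L (x : L) :=
    fun x => spectralNorm.eq_of_tower x
  have hρi : (⟨ρ, hρ.mem⟩ : tameField K L) ∈ integers K (tameField K L) := by
    rw [mem_integers_iff, hn]
    exact hρ.lt_one.le
  have hu : IsLocalRing.maximalIdeal (integers K (tameField K L))
      = Ideal.span {⟨⟨ρ, hρ.mem⟩, hρi⟩} := by
    ext x
    rw [mem_maximalIdeal_integers, mem_span_singleton_integers, hn, hn]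
    exact ⟨fun h => hρ.le_of_lt_one (x : tameField K L).2 h, fun h => h.trans_lt hρ.lt_one⟩
  unfold IsUniformizer
  rw [hu]
  constructor
  · intro h
    have h1 : (⟨⟨ρ, hρ.mem⟩, hρi⟩ : integers K (tameField K L)) ∈ Ideal.span {π} :=
      h ▸ Ideal.mem_span_singleton_self _
    have h2 : π ∈ Ideal.span {(⟨⟨ρ, hρ.mem⟩, hρi⟩ : integers K (tameField K L))} :=
      h ▸ Ideal.mem_span_singleton_self _
    rw [mem_span_singleton_integers, hn, hn] at h1 h2
    exact le_antisymm h2 h1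
  · intro h
    ext x
    rw [mem_span_singleton_integers, mem_span_singleton_integers, hn, hn, hn, h]

/-- The value of the tame character at `σ` corresponds to the `|Γ₁|`-th power of the residue class
of `σ π / π`, for a prime element `π` of `L`: the norm of `π` is a prime element of `L^{Γ₁}`. -/
theorem corresponds_tameChar {π : L} (hπ : IsPrimeElt K L ⊤ π) (σ : ramGroup K L 0) :
    e.Corresponds ((tameChar e L σ : Qalgˣ) : Qalg)
      (tameRes Kalg (σ : L ≃ₐ[K] L) π ^ Nat.card (ramGroup K L 1)) := by
  obtain ⟨ρ, hρ⟩ := exists_isPrimeElt K (tameField K L)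
  have hnorm : spectralNorm K L ρ = spectralNorm K L (π ^ Nat.card (ramGroup K L 1)) := by
    rw [specNorm_prime_of_le_inertia (ramGroup_antitone K L (Nat.zero_le 1)) hπ hρ, specNorm_pow]
  have hres : tameRes Kalg (σ : L ≃ₐ[K] L) ρ
      = tameRes Kalg (σ : L ≃ₐ[K] L) π ^ Nat.card (ramGroup K L 1) := by
    rw [tameRes_congr σ.2 (pow_ne_zero _ hπ.ne_zero) hnorm, tameRes_pow]
  have hroot : tameRes Kalg (σ : L ≃ₐ[K] L) ρ ^ tameDegree K L = 1 := by
    have h1 : tameRes Kalg (σ : L ≃ₐ[K] L) π ^ tameDegree K L = 1 := by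
      change tameResHom Kalg hπ.ne_zero σ ^ tameDegree K L = 1
      rw [← map_pow]
      exact (tameRes_prime_eq_one_iff hπ (σ ^ tameDegree K L).2).2
        (ramGroup_zero_pow_tameDegree_mem σ.2)
    rw [hres, ← pow_mul, mul_comm, pow_mul, h1, one_pow]
  -- For a uniformizer `ϖ` of the tame field, `u ϖ = σ ϖ` means that `u` is `σ ϖ / ϖ`.
  have hchar : ∀ ζ : rootsOfUnity (tameDegree K L) Qalg,
      (∃ ϖ : integers K (tameField K L), IsUniformizer K (tameField K L) ϖ ∧
        ∃ u : integers K Kalg,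
          (u : Kalg) * (((ϖ : tameField K L) : L) : Kalg)
            = ((σ : L ≃ₐ[K] L) (ϖ : tameField K L) : L) ∧
          e.Corresponds ((ζ : Qalgˣ) : Qalg) (IsLocalRing.residue (integers K Kalg) u)) ↔
      e.Corresponds ((ζ : Qalgˣ) : Qalg) (tameRes Kalg (σ : L ≃ₐ[K] L) ρ) := by
    intro ζ
    constructor
    · rintro ⟨ϖ, hϖ, u, hu, hc⟩
      have hϖn := (isUniformizer_tameField_iff hρ ϖ).1 hϖ
      have hϖ0 : ((ϖ : tameField K L) : L) ≠ 0 := fun h => by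
        rw [h, spectralNorm_zero] at hϖn
        exact hρ.pos.ne hϖn
      rw [tameRes_congr σ.2 hϖ0 hϖn.symm]
      convert hc using 1
      rw [tameRes]
      congr 1
      apply Subtype.ext
      have hϖ0' : (((ϖ : tameField K L) : L) : Kalg) ≠ 0 := by exact_mod_cast hϖ0
      rw [eq_div_of_mul_eq hϖ0' hu]
      exact map_div₀ (algebraMap L Kalg) _ _
    · intro hc
      have hint : (⟨ρ, hρ.mem⟩ : tameField K L) ∈ integers K (tameField K L) := by
        rw [mem_integers_iff, spectralNorm.eq_of_tower (L := L)]
        exact hρ.lt_one.le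
      refine ⟨⟨⟨ρ, hρ.mem⟩, hint⟩, (isUniformizer_tameField_iff hρ _).2 rfl,
        ⟨algebraMap L Kalg ((σ : L ≃ₐ[K] L) ρ / ρ), ?_⟩, ?_, hc⟩
      · rw [mem_integers_iff, ← spectralNorm.eq_of_tower, specNorm_div, specNorm_algEquiv]
        exact div_self_le_one _
      change algebraMap L Kalg ((σ : L ≃ₐ[K] L) ρ / ρ) * algebraMap L Kalg ρ
        = algebraMap L Kalg ((σ : L ≃ₐ[K] L) ρ)
      rw [← map_mul, div_mul_cancel₀ _ hρ.ne_zero]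
  obtain ⟨ζ, hζ⟩ := e.exists_corresponds tameDegree_ne_zero hroot
  have := Classical.epsilon_spec (p := fun ζ : rootsOfUnity (tameDegree K L) Qalg =>
    ∃ ϖ : integers K (tameField K L), IsUniformizer K (tameField K L) ϖ ∧
      ∃ u : integers K Kalg,
        (u : Kalg) * (((ϖ : tameField K L) : L) : Kalg)
          = ((σ : L ≃ₐ[K] L) (ϖ : tameField K L) : L) ∧
        e.Corresponds ((ζ : Qalgˣ) : Qalg) (IsLocalRing.residue (integers K Kalg) u))
    ⟨ζ, (hchar ζ).2 hζ⟩
  rw [← hres]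
  exact (hchar _).1 this

theorem tameChar_pow (σ : ramGroup K L 0) :
    ((tameChar e L σ : Qalgˣ) : Qalg) ^ tameDegree K L = 1 := by
  simpa using congrArg Units.val ((mem_rootsOfUnity _ _).1 (tameChar e L σ).2)

/-- The tame character as a homomorphism. -/
def tameCharHom : ramGroup K L 0 →* Qalgˣ :=
  MonoidHom.mk' (fun σ => (tameChar e L σ : Qalgˣ)) fun σ τ => by
    obtain ⟨π, hπ⟩ := exists_isPrimeElt K (⊤ : IntermediateField K L)
    apply Units.ext
    have h := (corresponds_tameChar e L hπ σ).mul (corresponds_tameChar e L hπ τ)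
    rw [← mul_pow, ← tameRes_mul_left σ.2 _ hπ.ne_zero] at h
    refine RootEmbedding.Corresponds.unique_left (tameDegree_residue_ne_zero K Kalg L)
      (tameChar_pow e L _) ?_ (corresponds_tameChar e L hπ (σ * τ)) h
    rw [Units.val_mul, mul_pow, tameChar_pow, tameChar_pow, one_mul]

theorem tameCharHom_apply (σ : ramGroup K L 0) : tameCharHom e L σ = tameChar e L σ := rfl

/-- The tame character induces an injection of `Γ₀/Γ₁`. -/
theorem tameCharHom_eq_one_iff (σ : ramGroup K L 0) :
    tameCharHom e L σ = 1 ↔ (σ : L ≃ₐ[K] L) ∈ ramGroup K L 1 := by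
  obtain ⟨π, hπ⟩ := exists_isPrimeElt K (⊤ : IntermediateField K L)
  have hc := corresponds_tameChar e L hπ σ
  constructor
  · intro h
    have h1 : ((tameChar e L σ : Qalgˣ) : Qalg) = 1 := congrArg Units.val h
    rw [h1] at hc
    have h2 := hc.unique_right e.corresponds_one
    have h3 : tameRes Kalg (σ : L ≃ₐ[K] L) π ^ tameDegree K L = 1 := by
      change tameResHom Kalg hπ.ne_zero σ ^ tameDegree K L = 1
      rw [← map_pow]
      exact (tameRes_prime_eq_one_iff hπ (σ ^ tameDegree K L).2).2
        (ramGroup_zero_pow_tameDegree_mem σ.2)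
    rw [← tameRes_prime_eq_one_iff (Ω := Kalg) hπ σ.2]
    have h4 := pow_gcd_eq_one.2 ⟨h3, h2⟩
    rwa [Nat.Coprime.gcd_eq_one (coprime_tameDegree_card K L L), pow_one] at h4
  · intro h
    rw [(tameRes_prime_eq_one_iff hπ σ.2).2 h, one_pow] at hc
    exact Units.ext (RootEmbedding.Corresponds.unique_left (tameDegree_residue_ne_zero K Kalg L)
      (tameChar_pow e L σ) (one_pow _) hc e.corresponds_one)

/-- The tame character maps onto `μ_n`. -/
theorem exists_orderOf_tameCharHom :
    ∃ σ : ramGroup K L 0, orderOf (tameCharHom e L σ) = tameDegree K L := by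
  have hker : (tameCharHom e L).ker = (ramGroup K L 1).subgroupOf (ramGroup K L 0) := by
    ext σ
    rw [MonoidHom.mem_ker, tameCharHom_eq_one_iff, Subgroup.mem_subgroupOf]
  have hcard : Nat.card (tameCharHom e L).range = tameDegree K L := by
    rw [← Subgroup.index_ker, hker]
    rfl
  have : Finite (tameCharHom e L).range :=
    Nat.finite_of_card_ne_zero (hcard ▸ tameDegree_ne_zero)
  obtain ⟨⟨_, σ, rfl⟩, hg⟩ := IsCyclic.exists_generator (α := (tameCharHom e L).range)
  refine ⟨σ, ?_⟩
  rw [← hcard, ← orderOf_eq_card_of_forall_mem_zpowers hg]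
  exact (Subgroup.orderOf_mk _ _).symm

variable (M : IntermediateField K Kalg) [FiniteDimensional K M] [IsGalois K M] [Algebra M L]
  [IsScalarTower K M L] [IsScalarTower M L Kalg]

theorem tameRes_inertiaRes (σ : ramGroup K L 0) (x : M) :
    tameRes Kalg (inertiaRes K M L σ : M ≃ₐ[K] M) x
      = tameRes Kalg (σ : L ≃ₐ[K] L) (algebraMap M L x) := by
  unfold tameRes
  congr 1
  apply Subtype.ext
  change algebraMap M Kalg _ = algebraMap L Kalg _
  rw [IsScalarTower.algebraMap_apply M L Kalg, map_div₀ (algebraMap M L), algebraMap_inertiaRes]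

/-- The tame character of `M` is a power of that of `L`, the exponent being the tame part of the
ramification index of `L/M`. -/
theorem exists_tameCharHom_inertiaRes : ∃ k : ℕ, k ≠ 0 ∧ tameDegree K L = k * tameDegree K M ∧
    ∀ σ, tameCharHom e M (inertiaRes K M L σ) = tameCharHom e L σ ^ k := by
  obtain ⟨π, hπ⟩ := exists_isPrimeElt K (⊤ : IntermediateField K L)
  obtain ⟨ρ, hρ⟩ := exists_isPrimeElt K (⊤ : IntermediateField K M)
  have hcard := card_inertia_eq K M L
  rw [← tameDegree_mul_card K L, ← tameDegree_mul_card K M] at hcard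
  have hdvd : Nat.card (ramGroup K L 1)
      ∣ Nat.card (inertiaRes K M L).ker * Nat.card (ramGroup K M 1) := by
    refine (coprime_tameDegree_card K M L).symm.dvd_of_dvd_mul_left ?_
    rw [← mul_assoc, mul_comm (tameDegree K M), mul_assoc, ← hcard]
    exact dvd_mul_left _ _
  obtain ⟨k, hk⟩ := hdvd
  have hdegk : tameDegree K L = k * tameDegree K M := by
    apply Nat.eq_of_mul_eq_mul_right (Nat.card_pos (α := ramGroup K L 1))
    rw [hcard, mul_left_comm, hk]
    ring
  have hk0 : k ≠ 0 := by
    rintro rfl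
    rw [zero_mul] at hdegk
    exact tameDegree_ne_zero hdegk
  refine ⟨k, hk0, hdegk, fun σ => Units.ext ?_⟩
  have hM := corresponds_tameChar e M hρ (inertiaRes K M L σ)
  have hL := (corresponds_tameChar e L hπ σ).pow k
  have hnorm : spectralNorm K L (algebraMap M L ρ)
      = spectralNorm K L (π ^ Nat.card (inertiaRes K M L).ker) := by
    rw [specNorm_algebraMap_prime hρ hπ, specNorm_pow]
  rw [tameRes_inertiaRes, tameRes_congr σ.2 (pow_ne_zero _ hπ.ne_zero) hnorm, tameRes_pow,
    ← pow_mul, hk, pow_mul] at hM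
  rw [Units.val_pow_eq_pow_val]
  refine RootEmbedding.Corresponds.unique_left (tameDegree_residue_ne_zero K Kalg L) ?_ ?_ hM hL
  · rw [hdegk, mul_comm, pow_mul]
    exact (congrArg (· ^ k) (tameChar_pow e M (inertiaRes K M L σ))).trans (one_pow k)
  · rw [← pow_mul, mul_comm, pow_mul]
    exact (congrArg (· ^ k) (tameChar_pow e L σ)).trans (one_pow k)

/-- The odd parts of the tame terms of the refined Artin characters are compatible. The values of
the tame character of `L` on the kernel of `Γ₀(L/K) → Γ₀(M/K)` are the `k`-th roots of unity, for
the exponent `k` with `ψ_M = ψ_L^k`. -/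
theorem pushforward_bArOdd_tameCharHom :
    pushforward (inertiaRes K M L) (fun σ => bArOdd (tameCharHom e L σ : Qalgˣ))
      = fun σ => bArOdd (tameCharHom e M σ : Qalgˣ) := by
  obtain ⟨k, hk0, hdeg, hk⟩ := exists_tameCharHom_inertiaRes e L M
  ext s
  obtain ⟨σ, rfl⟩ := inertiaRes_surjective K M L s
  rw [pushforward_of_surjective _ (inertiaRes_surjective K M L)
    (fun g h => by rw [map_mul, map_mul, map_inv, mul_inv_cancel_comm]), hk,
    Units.val_pow_eq_pow_val]
  let ψ : (inertiaRes K M L).ker →* Qalg :=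
    (Units.coeHom Qalg).comp ((tameCharHom e L).comp (inertiaRes K M L).ker.subtype)
  have hψ : ∀ h, ψ h = (tameCharHom e L h : Qalgˣ) := fun h => rfl
  rw [← average_bArOdd ψ (k := k) ?_ ?_ (Units.ne_zero _) hk0]
  · simp_rw [map_mul, Units.val_mul, hψ]
  · intro h
    rw [hψ, ← Units.val_pow_eq_pow_val, ← hk, MonoidHom.mem_ker.1 h.2, map_one, Units.val_one]
  · intro j hj0 hjk
    -- A power of an element on which `ψ_L` has order `n_L` lies in the kernel, and has order `k`.
    obtain ⟨τ, hτ⟩ := exists_orderOf_tameCharHom e L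
    set c := Nat.card (ramGroup K M 1)
    have hmem : τ ^ (tameDegree K M * c) ∈ (inertiaRes K M L).ker := by
      rw [MonoidHom.mem_ker, map_pow, tameDegree_mul_card, pow_card_eq_one']
    refine ⟨⟨_, hmem⟩, fun h => ?_⟩
    rw [hψ, ← Units.val_pow_eq_pow_val, Units.val_eq_one, map_pow, ← pow_mul,
      ← orderOf_dvd_iff_pow_eq_one, hτ, hdeg, mul_comm k, mul_assoc] at h
    have h3 := Nat.dvd_of_mul_dvd_mul_left (Nat.pos_of_ne_zero tameDegree_ne_zero) h
    have hcop : Nat.Coprime k c :=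
      Nat.Coprime.coprime_dvd_left ⟨_, hdeg⟩ (coprime_tameDegree_card K L M)
    exact absurd (Nat.le_of_dvd hj0 (hcop.dvd_of_dvd_mul_left h3)) (not_le.2 hjk)

/-! ### The refined Artin character -/

/-- The refined Artin character is induced from the sum of an odd tame term and half of the Artin
character of the inertia group: by the identity `bAr_n = bArOdd + (n/2) δ₁ - ½` on `μ_n`, the terms
`bAr_n ∘ ψ + ½ Ind u_{Γ₁}` add up to `bArOdd ∘ ψ + ½ u_{Γ₀}`. -/
theorem refinedArtinChar_eq : refinedArtinChar e L = pushforward (ramGroup K L 0).subtype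
    ((fun σ => bArOdd (tameCharHom e L σ : Qalgˣ)) + (1 / 2 : Qalg) • inertiaArtinChar K L) := by
  classical
  unfold refinedArtinChar
  congr 1
  obtain ⟨N, hN0, hsum, -, hsum1, -⟩ := exists_inertiaArtinChar_eq_sum K L
  obtain ⟨N, rfl⟩ := Nat.exists_eq_succ_of_ne_zero hN0.ne'
  rw [hsum1, hsum, Finset.sum_range_succ', Nat.succ_sub_one, smul_add,
    add_comm (_ • Finset.sum _ _), ← add_assoc]
  congr 1
  have hc0 : (Nat.card (ramGroup K L 0) : Qalg) ≠ 0 := by exact_mod_cast Nat.card_pos.ne'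
  have hc1 : (Nat.card (ramGroup K L 1) : Qalg) ≠ 0 := by exact_mod_cast Nat.card_pos.ne'
  ext σ
  have h1 : tameChar e L σ = 1 ↔ (σ : L ≃ₐ[K] L) ∈ ramGroup K L 1 := by
    rw [← tameCharHom_eq_one_iff e, tameCharHom_apply, OneMemClass.coe_eq_one]
  have hn : (tameDegree K L : Qalg)
      = Nat.card (ramGroup K L 0) / Nat.card (ramGroup K L 1) := relIndex_ramGroup K L 1
  simp only [Pi.add_apply, Pi.smul_apply, smul_eq_mul, bArTame, bArRoots_eq tameDegree_ne_zero,
    inducedAug_apply, tameCharHom_apply, h1, hn, σ.2, if_true, Subgroup.relIndex_self,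
    Nat.cast_one, inv_one, one_mul, div_self hc0]
  split_ifs <;> ring

theorem refinedArtinChar_add_conj :
    refinedArtinChar e L + conj (refinedArtinChar e L) = artinChar K L := by
  rw [refinedArtinChar_eq, ← pushforward_conj, ← pushforward_add, artinChar_eq]
  congr 1
  ext σ
  have hodd : bArOdd ((tameCharHom e L σ⁻¹ : Qalgˣ) : Qalg)
      = -bArOdd ((tameCharHom e L σ : Qalgˣ) : Qalg) := by
    rw [map_inv, Units.val_inv_eq_inv_val, bArOdd_inv (Units.ne_zero _)]
  have hart : inertiaArtinChar K L σ⁻¹ = inertiaArtinChar K L σ :=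
    congrFun (conj_inertiaArtinChar K L) σ
  simp only [Pi.add_apply, Pi.smul_apply, conj, smul_eq_mul, hodd, hart]
  ring

theorem subtype_comp_inertiaRes : (AlgEquiv.restrictNormalHom M).comp (ramGroup K L 0).subtype
    = (ramGroup K M 0).subtype.comp (inertiaRes K M L) := rfl

theorem pushforward_refinedArtinChar :
    pushforward (AlgEquiv.restrictNormalHom M) (refinedArtinChar e L) = refinedArtinChar e M := by
  rw [refinedArtinChar_eq, refinedArtinChar_eq, pushforward_pushforward, subtype_comp_inertiaRes,
    ← pushforward_pushforward, pushforward_add, pushforward_smul, pushforward_inertiaArtinChar,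
    pushforward_bArOdd_tameCharHom]

theorem pushforward_artinChar :
    pushforward (AlgEquiv.restrictNormalHom M) (artinChar K L) = artinChar K M := by
  rw [artinChar_eq, artinChar_eq, pushforward_pushforward, subtype_comp_inertiaRes,
    ← pushforward_pushforward, pushforward_inertiaArtinChar]

end TameChar

/-! ### Distributions from compatible systems of functions -/

section Krull

variable {K Kalg : Type*} [Field K] [Field Kalg] [Algebra K Kalg] [Normal K Kalg]

theorem exists_fixing_subset {U : Set (Kalg ≃ₐ[K] Kalg)} (hU : U ∈ nhds 1) :
    ∃ L : FiniteGaloisIntermediateField K Kalg,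
      ((L : IntermediateField K Kalg).fixingSubgroup : Set (Kalg ≃ₐ[K] Kalg)) ⊆ U := by
  obtain ⟨N, hNf, hNn, hN⟩ := (krullTopology_mem_nhds_one_iff_of_normal K Kalg U).1 hU
  -- `Kalg` need not be separable over `K`: `N` is purely inseparable over its separable part.
  have hsep : IsGalois K ↥(N ⊓ separableClosure K Kalg) :=
    { to_isSeparable := inferInstance
      to_normal := IntermediateField.normal_inf K Kalg N (separableClosure K Kalg) }
  refine ⟨⟨N ⊓ separableClosure K Kalg⟩, fun σ hσ => hN ?_⟩
  rw [SetLike.mem_coe, IntermediateField.mem_fixingSubgroup_iff] at hσ ⊢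
  intro x hx
  obtain ⟨q, hq⟩ := ExpChar.exists (separableClosure K Kalg)
  have : ExpChar Kalg q := expChar_of_injective_algebraMap
    (algebraMap (separableClosure K Kalg) Kalg).injective q
  obtain ⟨n, y, hy⟩ := IsPurelyInseparable.pow_mem (separableClosure K Kalg) q x
  have h1 : x ^ q ^ n ∈ N ⊓ separableClosure K Kalg :=
    ⟨pow_mem hx _, by rw [← hy]; exact y.2⟩
  have h2 := hσ _ h1
  rw [map_pow] at h2
  exact iterateFrobenius_inj Kalg q n h2

/-- A locally constant function on the Galois group factors through a finite Galois extension. -/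
theorem exists_finiteGalois_factor {X : Type*} {f : (Kalg ≃ₐ[K] Kalg) → X}
    (hf : IsLocallyConstant f) : ∃ L : FiniteGaloisIntermediateField K Kalg,
      ∀ σ τ : Kalg ≃ₐ[K] Kalg, (∀ x ∈ (L : IntermediateField K Kalg), σ x = τ x) → f σ = f τ := by
  have hloc : ∀ σ : Kalg ≃ₐ[K] Kalg, ∃ L : FiniteGaloisIntermediateField K Kalg,
      ∀ τ : Kalg ≃ₐ[K] Kalg, (∀ x ∈ (L : IntermediateField K Kalg), τ x = σ x) → f τ = f σ := by
    intro σ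
    have h1 : (fun τ => σ * τ) ⁻¹' {τ | f τ = f σ} ∈ nhds 1 := by
      refine (continuous_const_mul σ).continuousAt.preimage_mem_nhds ?_
      rw [mul_one]
      exact (hf.isOpen_fiber (f σ)).mem_nhds rfl
    obtain ⟨L, hL⟩ := exists_fixing_subset h1
    refine ⟨L, fun τ hτ => ?_⟩
    have h2 : σ⁻¹ * τ ∈ (L : IntermediateField K Kalg).fixingSubgroup := by
      rw [IntermediateField.mem_fixingSubgroup_iff]
      intro x hx
      rw [AlgEquiv.mul_apply, hτ x hx, ← AlgEquiv.mul_apply, inv_mul_cancel, AlgEquiv.one_apply]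
    have h3 := hL h2
    simpa using h3
  choose L hL using hloc
  -- The Galois group of the separable closure is compact.
  let S := separableClosure K Kalg
  have hLS : ∀ σ, (L σ : IntermediateField K Kalg) ≤ S := fun σ =>
    le_separableClosure K Kalg _
  let V : (Kalg ≃ₐ[K] Kalg) → Set (S ≃ₐ[K] S) := fun σ =>
    {s | ∀ x (hx : x ∈ (L σ).toIntermediateField), (s ⟨x, hLS σ hx⟩ : Kalg) = σ x}
  have hres : ∀ (σ : Kalg ≃ₐ[K] Kalg) (x : S),
      (AlgEquiv.restrictNormalHom S σ x : Kalg) = σ x :=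
    fun σ x => AlgEquiv.restrictNormal_commutes σ S x
  have hVopen : ∀ σ, IsOpen (V σ) := by
    intro σ
    have hfin : FiniteDimensional K (IntermediateField.restrict (hLS σ)) :=
      (IntermediateField.restrictAlgEquiv (hLS σ)).toLinearEquiv.finiteDimensional
    have hopen := (IntermediateField.restrict (hLS σ)).fixingSubgroup_isOpen
    have hV : V σ = (fun s => (AlgEquiv.restrictNormalHom S σ)⁻¹ * s) ⁻¹'
        (IntermediateField.restrict (hLS σ)).fixingSubgroup := by
      ext s
      rw [Set.mem_preimage, SetLike.mem_coe, IntermediateField.mem_fixingSubgroup_iff]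
      have key : ∀ x : S, ((AlgEquiv.restrictNormalHom S σ)⁻¹ * s) x = x ↔ (s x : Kalg) = σ x := by
        intro x
        rw [AlgEquiv.mul_apply, ← hres, ← Subtype.ext_iff]
        exact AlgEquiv.symm_apply_eq _
      constructor
      · intro hs x hx
        exact (key x).2 (hs x ((IntermediateField.mem_restrict (hLS σ) x).1 hx))
      · intro hs x hx
        exact (key ⟨x, hLS σ hx⟩).1 (hs _ ((IntermediateField.mem_restrict (hLS σ) _).2 hx))
    rw [hV]
    exact hopen.preimage (continuous_const_mul _)
  obtain ⟨t, ht⟩ := isCompact_univ.elim_finite_subcover V hVopen fun s _ => by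
    obtain ⟨σ, rfl⟩ := AlgEquiv.restrictNormalHom_surjective (K₁ := S) Kalg s
    exact Set.mem_iUnion.2 ⟨σ, fun x hx => hres σ ⟨x, hLS σ hx⟩⟩
  refine ⟨t.sup L, fun σ τ hστ => ?_⟩
  obtain ⟨ρ, hρt, hρ⟩ := Set.mem_iUnion₂.1 (ht (Set.mem_univ (AlgEquiv.restrictNormalHom S σ)))
  have h1 : ∀ x ∈ (L ρ).toIntermediateField, σ x = ρ x := fun x hx => by
    rw [← hρ x hx, hres]
  have hle : L ρ ≤ t.sup L := Finset.le_sup hρt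
  rw [hL ρ σ h1, hL ρ τ fun x hx => by rw [← hστ x (hle hx), h1 x hx]]

end Krull

section Compatible

variable {K Kalg F : Type*} [Field K] [Field Kalg] [Algebra K Kalg] [Normal K Kalg] [Field F]

theorem restrictHom_restrictNormalHom {M L : FiniteGaloisIntermediateField K Kalg} (h : M ≤ L)
    (σ : Kalg ≃ₐ[K] Kalg) :
    restrictHom h (AlgEquiv.restrictNormalHom L σ) = AlgEquiv.restrictNormalHom M σ := by
  ext x
  rw [coe_restrictHom]
  exact (AlgEquiv.restrictNormal_commutes σ L _).trans
    (AlgEquiv.restrictNormal_commutes σ M x).symm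

/-- `f` is the inflation of the function `φ` on `Gal(L/K)`. -/
def IsInflation (f : (Kalg ≃ₐ[K] Kalg) → F) (L : FiniteGaloisIntermediateField K Kalg)
    (φ : (L ≃ₐ[K] L) → F) : Prop :=
  ∀ σ : Kalg ≃ₐ[K] Kalg, f σ = φ (AlgEquiv.restrictNormalHom L σ)

theorem IsInflation.of_le {f : (Kalg ≃ₐ[K] Kalg) → F} {M L : FiniteGaloisIntermediateField K Kalg}
    {φ : (M ≃ₐ[K] M) → F} (hφ : IsInflation f M φ) (h : M ≤ L) :
    IsInflation f L (φ ∘ restrictHom h) := fun σ => by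
  rw [Function.comp, restrictHom_restrictNormalHom, hφ σ]

theorem restrictNormalHom_surjective (L : FiniteGaloisIntermediateField K Kalg) :
    Function.Surjective (AlgEquiv.restrictNormalHom L : (Kalg ≃ₐ[K] Kalg) →* (L ≃ₐ[K] L)) :=
  AlgEquiv.restrictNormalHom_surjective (K₁ := L) Kalg

theorem IsInflation.isCentral {f : (Kalg ≃ₐ[K] Kalg) → F} {L : FiniteGaloisIntermediateField K Kalg}
    {φ : (L ≃ₐ[K] L) → F} (hφ : IsInflation f L φ) (hf : IsCentral f) : IsCentral φ := by
  intro g h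
  obtain ⟨σ, rfl⟩ := restrictNormalHom_surjective L g
  obtain ⟨τ, rfl⟩ := restrictNormalHom_surjective L h
  rw [← map_mul, ← map_inv, ← map_mul, ← hφ, ← hφ, hf]

theorem IsInflation.unique {f : (Kalg ≃ₐ[K] Kalg) → F} {L : FiniteGaloisIntermediateField K Kalg}
    {φ φ' : (L ≃ₐ[K] L) → F} (hφ : IsInflation f L φ) (hφ' : IsInflation f L φ') : φ = φ' := by
  ext g
  obtain ⟨σ, rfl⟩ := restrictNormalHom_surjective L g
  rw [← hφ, ← hφ']

theorem exists_isInflation (f : LocConstCentral (Kalg ≃ₐ[K] Kalg) F) :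
    ∃ (L : FiniteGaloisIntermediateField K Kalg) (φ : (L ≃ₐ[K] L) → F), IsInflation f.1 L φ := by
  obtain ⟨L, hL⟩ := exists_finiteGalois_factor f.2.1
  refine ⟨L, fun g => f.1 (Function.surjInv (restrictNormalHom_surjective L) g), fun σ => ?_⟩
  refine hL _ _ fun x hx => ?_
  have h := Function.surjInv_eq (restrictNormalHom_surjective L) (AlgEquiv.restrictNormalHom L σ)
  have h1 := AlgEquiv.restrictNormal_commutes σ L ⟨x, hx⟩
  have h2 := AlgEquiv.restrictNormal_commutes
    (Function.surjInv (restrictNormalHom_surjective L) (AlgEquiv.restrictNormalHom L σ)) L ⟨x, hx⟩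
  refine h1.symm.trans (Eq.trans ?_ h2)
  exact congrArg (fun g : L ≃ₐ[K] L => ((g ⟨x, hx⟩ : L) : Kalg)) h.symm

variable [Algebra Qalg F]

theorem pushforward_algebraMap {G G' : Type*} [Group G] [Group G'] [Finite G] [Finite G']
    (α : G →* G') (χ : G → Qalg) : pushforward α (fun g => algebraMap Qalg F (χ g))
      = fun g => algebraMap Qalg F (pushforward α χ g) := by
  classical
  have := Fintype.ofFinite G
  have := Fintype.ofFinite G'
  ext g'
  simp only [pushforward_apply, map_mul, map_inv₀, map_natCast, map_sum]
  congr 1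
  refine Finset.sum_congr rfl fun x _ => Finset.sum_congr rfl fun g _ => ?_
  split_ifs <;> simp

variable {χ : ∀ L : FiniteGaloisIntermediateField K Kalg, (L ≃ₐ[K] L) → Qalg}

theorem pairing_comp_restrictHom
    (hχ : ∀ (L M : FiniteGaloisIntermediateField K Kalg) (h : M ≤ L),
      pushforward (restrictHom h) (χ L) = χ M)
    {M L : FiniteGaloisIntermediateField K Kalg} (h : M ≤ L) {φ : (M ≃ₐ[K] M) → F}
    (hφ : IsCentral φ) :
    pairing (fun g => algebraMap Qalg F (χ L g)) (φ ∘ restrictHom h)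
      = pairing (fun g => algebraMap Qalg F (χ M g)) φ := by
  have : CharZero F := charZero_of_injective_algebraMap (algebraMap Qalg F).injective
  rw [pairing_comm, ← pairing_pushforward _ _ _ hφ, pushforward_algebraMap, hχ, pairing_comm]

theorem pairing_eq_of_isInflation
    (hχ : ∀ (L M : FiniteGaloisIntermediateField K Kalg) (h : M ≤ L),
      pushforward (restrictHom h) (χ L) = χ M)
    {f : (Kalg ≃ₐ[K] Kalg) → F} (hf : IsCentral f) {L M : FiniteGaloisIntermediateField K Kalg}
    {φ : (L ≃ₐ[K] L) → F} {φ' : (M ≃ₐ[K] M) → F} (hφ : IsInflation f L φ)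
    (hφ' : IsInflation f M φ') : pairing (fun g => algebraMap Qalg F (χ L g)) φ
      = pairing (fun g => algebraMap Qalg F (χ M g)) φ' := by
  have h1 := hφ.of_le (le_sup_left : L ≤ L ⊔ M)
  have h2 := hφ'.of_le (le_sup_right : M ≤ L ⊔ M)
  rw [← pairing_comp_restrictHom hχ le_sup_left (hφ.isCentral hf),
    ← pairing_comp_restrictHom hχ le_sup_right (hφ'.isCentral hf), h1.unique h2]

/-- A system of functions on the groups `Gal(L/K)` that is compatible with pushforward defines
exactly one distribution. -/
theorem existsUnique_isDefinedBy
    (hχ : ∀ (L M : FiniteGaloisIntermediateField K Kalg) (h : M ≤ L),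
      pushforward (restrictHom h) (χ L) = χ M) :
    ∃! D : Distribution (Kalg ≃ₐ[K] Kalg) F, D.IsDefinedBy χ := by
  choose L φ hφ using exists_isInflation (K := K) (Kalg := Kalg) (F := F)
  refine ⟨
    { toFun := fun f => pairing (fun g => algebraMap Qalg F (χ (L f) g)) (φ f)
      map_add' := fun f f' => ?_
      map_smul' := fun c f => ?_ }, fun M ψ f hf => ?_, fun D hD => ?_⟩
  · have h1 := (hφ f).of_le (le_sup_left : L f ≤ L f ⊔ L f')
    have h2 := (hφ f').of_le (le_sup_right : L f' ≤ L f ⊔ L f')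
    rw [pairing_eq_of_isInflation hχ f.2.2 (hφ f) h1,
      pairing_eq_of_isInflation hχ f'.2.2 (hφ f') h2, ← pairing_add]
    exact pairing_eq_of_isInflation hχ (f + f').2.2 (hφ (f + f')) fun σ =>
      congrArg₂ (· + ·) (h1 σ) (h2 σ)
  · rw [RingHom.id_apply, smul_eq_mul, ← pairing_smul]
    exact pairing_eq_of_isInflation hχ (c • f).2.2 (hφ (c • f)) fun σ =>
      congrArg (c * ·) (hφ f σ)
  · exact pairing_eq_of_isInflation hχ f.2.2 (hφ f) hf
  · exact LinearMap.ext fun f => hD (L f) (φ f) f (hφ f)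

end Compatible

end RefinedArtin

end

open RefinedArtin in
theorem proposition3p5 {K : Type*} [NontriviallyNormedField K] [IsUltrametricDist K]
    [CompleteSpace K] [IsDiscreteValuationRing 𝒪[K]] [PerfectField 𝓀[K]]
    {Kalg : Type*} [Field Kalg] [Algebra K Kalg] [IsAlgClosure K Kalg]
    (e : RootEmbedding K Kalg) {F : Type*} [Field F] [Algebra Qalg F] :
    (∀ (L M : FiniteGaloisIntermediateField K Kalg) (h : M ≤ L),
      pushforward (restrictHom h) (refinedArtinChar e L.toIntermediateField)
        = refinedArtinChar e M.toIntermediateField) ∧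
    (∃! D : Distribution (Kalg ≃ₐ[K] Kalg) F,
      D.IsDefinedBy fun L => refinedArtinChar e L.toIntermediateField) ∧
    (∃! A : Distribution (Kalg ≃ₐ[K] Kalg) F, A.IsDefinedBy fun L => artinChar K L) ∧
    ∀ D A : Distribution (Kalg ≃ₐ[K] Kalg) F,
      D.IsDefinedBy (fun L => refinedArtinChar e L.toIntermediateField) →
      A.IsDefinedBy (fun L => artinChar K L) →
      A = D + D.conj := by
  have : Normal K Kalg := IsAlgClosure.normal K Kalg
  have hbAr : ∀ (L M : FiniteGaloisIntermediateField K Kalg) (h : M ≤ L),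
      pushforward (restrictHom h) (refinedArtinChar e L.toIntermediateField)
        = refinedArtinChar e M.toIntermediateField := by
    intro L M h
    let _ : Algebra M L := RingHom.toAlgebra (IntermediateField.inclusion h)
    have : IsScalarTower K M L := IsScalarTower.of_algebraMap_eq (congrFun rfl)
    have : IsScalarTower M L Kalg := IsScalarTower.of_algebraMap_eq (congrFun rfl)
    exact pushforward_refinedArtinChar e L.toIntermediateField M.toIntermediateField
  have hAr : ∀ (L M : FiniteGaloisIntermediateField K Kalg) (h : M ≤ L),
      pushforward (restrictHom h) (artinChar K L) = artinChar K M := by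
    intro L M h
    let _ : Algebra M L := RingHom.toAlgebra (IntermediateField.inclusion h)
    have : IsScalarTower K M L := IsScalarTower.of_algebraMap_eq (congrFun rfl)
    have : IsScalarTower M L Kalg := IsScalarTower.of_algebraMap_eq (congrFun rfl)
    exact pushforward_artinChar L.toIntermediateField M.toIntermediateField
  refine ⟨hbAr, existsUnique_isDefinedBy hbAr, existsUnique_isDefinedBy hAr, fun D A hD hA => ?_⟩
  refine LinearMap.ext fun f => ?_
  obtain ⟨L, φ, hφ⟩ := exists_isInflation f
  have hφ' : ∀ σ : Kalg ≃ₐ[K] Kalg, (LocConstCentral.conj f).1 σ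
      = RefinedArtin.conj φ (AlgEquiv.restrictNormalHom L σ) := fun σ => by
    refine (hφ σ⁻¹).trans ?_
    rw [map_inv]
    rfl
  have h1 : (fun g => algebraMap Qalg F (artinChar K L g))
      = (fun g => algebraMap Qalg F (refinedArtinChar e L.toIntermediateField g))
        + RefinedArtin.conj
          (fun g => algebraMap Qalg F (refinedArtinChar e L.toIntermediateField g)) := by
    ext g
    rw [← refinedArtinChar_add_conj e L.toIntermediateField]
    simp [RefinedArtin.conj]
  have h2 : (D + D.conj) f = D f + D (LocConstCentral.conj f) := rfl
  rw [h2, hA L φ f hφ, hD L φ f hφ, hD L _ _ hφ', pairing_conj, h1, pairing_comm, pairing_add,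
    pairing_comm φ, pairing_comm φ]
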